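/- For an integer $n\ge 1$, consider the eigenvalue problem $$(-1)^n\psi^{(2n)}(t)=\lambda\,\psi(t)\quad(-1<t<1),\qquad \psi^{(j)}(\pm1)=0\quad(0\le j\le n-1).$$ A real number $\lambda$ is an eigenvalue if there is a solution $\psi\in C^{2n}([-1,1];\mathbb{R})$ that is not identically zero. Then this problem has a smallest eigenvalue, denoted $\lambda_n$, and for every $n\ge 1$ $$\frac{2\,\Gamma(n+1)\,\Gamma(2n+\frac12)}{\Gamma(n+\frac12)\,R_n}<\lambda_n<\frac{2\,\Gamma(n+1)\,\Gamma(2n+\frac12)}{\Gamma(n+\frac12)},$$ where $$R_n={}_3F_2\left(\tfrac12,1,-n;\,1-2n,\,n+1;\,1\right)=\sum_{k=0}^{n}\frac{(1/2)_k\,(1)_k\,(-n)_k}{(1-2n)_k\,(n+1)_k\,k!}$$ and $(a)_k=a(a+1)\cdots(a+k-1)$. Moreover, $R_n\to1$ as $n\to\infty$; consequently both the lower and the upper bound above are asymptotically equal to $\lambda_n$ as $n\to\infty$, and $$\lambda_n\sim\sqrt2\,(2n)!\qquad(n\to\infty).$$ -/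

import Mathlib

open Filter Topology Asymptotics Set

noncomputable section

/-- `ψ` belongs to `C^{2n}([-1,1])`, is not identically zero there, satisfies
`(-1)^n ψ^{(2n)} = μ ψ` on `(-1,1)`, and `ψ^{(j)}(±1) = 0` for `0 ≤ j ≤ n - 1`
(derivatives at the end points are one-sided). -/
structure IsPolyharmonicEigenfunction (n : ℕ) (μ : ℝ) (ψ : ℝ → ℝ) : Prop where
  contDiffOn : ContDiffOn ℝ (2 * n : ℕ) ψ (Icc (-1) 1)
  ne_zero : ∃ t ∈ Icc (-1 : ℝ) 1, ψ t ≠ 0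
  equation : ∀ t ∈ Ioo (-1 : ℝ) 1,
    (-1) ^ n * iteratedDerivWithin (2 * n) ψ (Icc (-1) 1) t = μ * ψ t
  left_boundary : ∀ j < n, iteratedDerivWithin j ψ (Icc (-1) 1) (-1) = 0
  right_boundary : ∀ j < n, iteratedDerivWithin j ψ (Icc (-1) 1) 1 = 0

/-- The set of eigenvalues of the polyharmonic boundary value problem of order `2n`. -/
def polyharmonicEigenvalues (n : ℕ) : Set ℝ :=
  {μ | ∃ ψ : ℝ → ℝ, IsPolyharmonicEigenfunction n μ ψ}

/-- The minimal eigenvalue `λ_n`. -/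
def minEigenvalue (n : ℕ) : ℝ :=
  sInf (polyharmonicEigenvalues n)

/-- The hypergeometric series `₃F₂(a₁, a₂, a₃; b₁, b₂; z)`, with `(a)_k` the rising factorial.
When an upper parameter is `-m` with `m` a natural number, the series stops at `k = m`
(all later terms are zero, also those where a lower Pochhammer symbol vanishes). -/
def hypergeometric3F2 (a₁ a₂ a₃ b₁ b₂ z : ℝ) : ℝ :=
  ∑' k : ℕ,
    ((ascPochhammer ℝ k).eval a₁ * (ascPochhammer ℝ k).eval a₂ * (ascPochhammer ℝ k).eval a₃) /
      ((ascPochhammer ℝ k).eval b₁ * (ascPochhammer ℝ k).eval b₂) * (z ^ k / k.factorial)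

/-- `R_n = ₃F₂(1/2, 1, -n; 1 - 2n, n + 1; 1)`. -/
def ratioR (n : ℕ) : ℝ :=
  hypergeometric3F2 (1 / 2) 1 (-(n : ℝ)) (1 - 2 * (n : ℝ)) ((n : ℝ) + 1) 1

/-- `2 Γ(n+1) Γ(2n+1/2) / Γ(n+1/2)`. -/
def eigenUpperBound (n : ℕ) : ℝ :=
  2 * Real.Gamma ((n : ℝ) + 1) * Real.Gamma (2 * (n : ℝ) + 1 / 2) / Real.Gamma ((n : ℝ) + 1 / 2)

/-- `2 Γ(n+1) Γ(2n+1/2) / (Γ(n+1/2) R_n)`. -/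
def eigenLowerBound (n : ℕ) : ℝ :=
  2 * Real.Gamma ((n : ℝ) + 1) * Real.Gamma (2 * (n : ℝ) + 1 / 2) /
    (Real.Gamma ((n : ℝ) + 1 / 2) * ratioR n)

end

set_option linter.unusedSectionVars false

/-! The Dirichlet problem is inverted by an integral operator `T` on `C([-1,1])` whose kernel is
Boggio's Green function. It is continuous, symmetric and nonnegative, and `⟨Tf, f⟩ = ∫ (u⁽ⁿ⁾)² ≥ 0`
for `u = Tf`. Hence `T` has a largest eigenvalue `M` (`exists_max_eigenvalue`), and `M⁻¹` is the
least eigenvalue of the problem (`isLeast_minEigenvalue`). Write `λ` for it and `U` for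
`eigenUpperBound n`.

Upper bound (`minEigenvalue_lt`): in `λ ⟨Tf, Tf⟩ ≤ ⟨Tf, f⟩` take `f = 1`. Since `T1 = (1 - t²)ⁿ /
(2n)!`, both sides are Beta integrals, and the quotient is `U / 2` times `(4n + 1) / (2n + 1) < 2`.

Lower bound (`lt_minEigenvalue`): for `w = (1 - t²)ⁿ` the solution is explicit, `Tw = U⁻¹ w ∑ cₖ (1
- t²)ᵏ` with `cₖ` the terms of `R_n`. This amounts to Chu–Vandermonde (`sum_ratioCoeff_mul_choose`).
As `cₖ ≥ 0`, it gives `Tw ≤ (R_n / U) w`. For an eigenfunction `f`, positivity of the kernel gives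
`|f| ≤ λ T|f|`; pairing with `w` yields `1 < λ R_n / U` (`one_lt_mul_of_mem_eigenvalues`).

The `cₖ` decay geometrically and `c₁ = O(1/n)`, so `R_n → 1`. The Wallis product then turns `U` into
`√2 (2n)!`. -/

noncomputable section

open MeasureTheory Polynomial

/-! ### Integral operators with continuous kernel -/

namespace ContinuousKernel

variable {K : Type*} [PseudoMetricSpace K] [CompactSpace K] [SecondCountableTopology K]
  [MeasurableSpace K] [BorelSpace K]

lemma integrable (μ : Measure K) [IsFiniteMeasure μ] (f : C(K, ℝ)) : Integrable f μ :=
  f.continuous.integrable_of_hasCompactSupport (HasCompactSupport.of_compactSpace _)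

/-- The bilinear form `(f, g) ↦ ∫ f g dμ` on continuous functions. -/
def pairing (μ : Measure K) [IsFiniteMeasure μ] : LinearMap.BilinForm ℝ C(K, ℝ) :=
  LinearMap.mk₂ ℝ (fun f g => ∫ x, f x * g x ∂μ)
    (fun f₁ f₂ g => by
      simp only [ContinuousMap.add_apply, add_mul]
      exact integral_add (integrable μ (f₁ * g)) (integrable μ (f₂ * g)))
    (fun c f g => by
      simp only [ContinuousMap.smul_apply, smul_eq_mul, mul_assoc]
      exact integral_const_mul _ _)
    (fun f g₁ g₂ => by
      simp only [ContinuousMap.add_apply, mul_add]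
      exact integral_add (integrable μ (f * g₁)) (integrable μ (f * g₂)))
    (fun c f g => by
      simp only [ContinuousMap.smul_apply, smul_eq_mul, mul_left_comm _ c]
      exact integral_const_mul _ _)

variable (μ : Measure K) [IsFiniteMeasure μ]

lemma pairing_apply (f g : C(K, ℝ)) : pairing μ f g = ∫ x, f x * g x ∂μ := rfl

lemma pairing_comm (f g : C(K, ℝ)) : pairing μ f g = pairing μ g f := by
  simp only [pairing_apply, mul_comm]

lemma pairing_self_nonneg (f : C(K, ℝ)) : 0 ≤ pairing μ f f :=
  integral_nonneg fun x => mul_self_nonneg (f x)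

lemma pairing_sq_le (f g : C(K, ℝ)) : pairing μ f g ^ 2 ≤ pairing μ f f * pairing μ g g :=
  LinearMap.BilinForm.apply_sq_le_of_symm _ (pairing_self_nonneg μ)
    ⟨fun f g => by simpa using pairing_comm μ f g⟩ f g

lemma pairing_mono {f g h : C(K, ℝ)} (hfg : ∀ x, f x ≤ g x) (hh : ∀ x, 0 ≤ h x) :
    pairing μ f h ≤ pairing μ g h :=
  integral_mono (integrable μ (f * h)) (integrable μ (g * h))
    fun x => mul_le_mul_of_nonneg_right (hfg x) (hh x)

lemma abs_pairing_le (f g : C(K, ℝ)) : |pairing μ f g| ≤ μ.real univ * ‖g‖ * ‖f‖ := by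
  have := norm_integral_le_of_norm_le_const (μ := μ) (f := fun x => f x * g x) (C := ‖f‖ * ‖g‖)
    (Eventually.of_forall fun x => by
      rw [norm_mul]
      exact mul_le_mul (f.norm_coe_le_norm x) (g.norm_coe_le_norm x) (norm_nonneg _)
        (norm_nonneg _))
  rw [pairing_apply, ← Real.norm_eq_abs]
  linarith

lemma pairing_self_le (f : C(K, ℝ)) : pairing μ f f ≤ μ.real univ * ‖f‖ ^ 2 := by
  have := (le_abs_self _).trans (abs_pairing_le μ f f)
  nlinarith

lemma continuous_pairing_left (g : C(K, ℝ)) : Continuous fun f => pairing μ f g :=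
  AddMonoidHomClass.continuous_of_bound ((pairing μ).flip g) (μ.real univ * ‖g‖)
    fun f => abs_pairing_le μ f g

/-- The integral operator on `C(K)` with continuous kernel `G`. -/
def op (G : C(K × K, ℝ)) : C(K, ℝ) →ₗ[ℝ] C(K, ℝ) where
  toFun f := ⟨fun t => pairing μ (G.curry t) f, (continuous_pairing_left μ f).comp G.curry.continuous⟩
  map_add' f g := by ext t; simp
  map_smul' c f := by ext t; simp

variable (G : C(K × K, ℝ))

lemma op_apply (f : C(K, ℝ)) (t : K) : op μ G f t = pairing μ (G.curry t) f := rfl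

lemma op_apply_eq_integral (f : C(K, ℝ)) (t : K) : op μ G f t = ∫ s, G (t, s) * f s ∂μ := rfl

lemma pairing_op_comm (hG : ∀ s t, G (s, t) = G (t, s)) (f g : C(K, ℝ)) :
    pairing μ (op μ G f) g = pairing μ f (op μ G g) := by
  simp only [pairing_apply, op_apply_eq_integral, ← integral_mul_const, ← integral_const_mul]
  rw [integral_integral_swap]
  · refine integral_congr_ae (Eventually.of_forall fun s => integral_congr_ae
      (Eventually.of_forall fun t => ?_))
    simp only [hG s t]; ring
  · have hc : Continuous (Function.uncurry fun x s => G (x, s) * f s * g x) := by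
      unfold Function.uncurry; fun_prop
    exact hc.integrable_of_hasCompactSupport (HasCompactSupport.of_compactSpace _)

lemma op_mono (hG : ∀ s t, 0 ≤ G (s, t)) {f g : C(K, ℝ)} (hfg : ∀ x, f x ≤ g x) (t : K) :
    op μ G f t ≤ op μ G g t := by
  rw [op_apply, op_apply, pairing_comm, pairing_comm μ _ g]
  exact pairing_mono μ hfg fun s => hG t s

lemma norm_curry_le (t : K) : ‖G.curry t‖ ≤ ‖G‖ :=
  (ContinuousMap.norm_le _ (norm_nonneg _)).2 fun s => G.norm_coe_le_norm (t, s)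

lemma norm_op_le (f : C(K, ℝ)) : ‖op μ G f‖ ≤ μ.real univ * ‖G‖ * ‖f‖ := by
  refine (ContinuousMap.norm_le _ (by positivity)).2 fun t => ?_
  refine (abs_pairing_le μ _ f).trans ?_
  rw [mul_right_comm]
  gcongr
  exact norm_curry_le G t

lemma continuous_op : Continuous (op μ G) :=
  AddMonoidHomClass.continuous_of_bound (op μ G) (μ.real univ * ‖G‖) (norm_op_le μ G)

/-- Cauchy–Schwarz in the integration variable. Mean-square bounds thereby become uniform bounds, so
the spectral argument can stay inside `C(K)` without completing to `L²`. -/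
lemma norm_op_sq_le (f : C(K, ℝ)) : ‖op μ G f‖ ^ 2 ≤ μ.real univ * ‖G‖ ^ 2 * pairing μ f f := by
  have hp := pairing_self_nonneg μ f
  have h : ‖op μ G f‖ ≤ √(μ.real univ * ‖G‖ ^ 2 * pairing μ f f) := by
    refine (ContinuousMap.norm_le _ (Real.sqrt_nonneg _)).2 fun t => Real.abs_le_sqrt ?_
    refine (pairing_sq_le μ _ f).trans (mul_le_mul_of_nonneg_right ?_ hp)
    refine (pairing_self_le μ _).trans ?_
    gcongr
    exact norm_curry_le G t
  calc ‖op μ G f‖ ^ 2 ≤ √(μ.real univ * ‖G‖ ^ 2 * pairing μ f f) ^ 2 := by gcongr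
    _ = _ := Real.sq_sqrt (by positivity)

/-- The modulus of continuity does not depend on `f`; this is the equicontinuity needed for
Arzelà–Ascoli. -/
lemma abs_op_sub_le {f : C(K, ℝ)} (hf : pairing μ f f ≤ 1) (s t : K) :
    |op μ G f s - op μ G f t| ≤ √(μ.real univ) * dist (G.curry s) (G.curry t) := by
  have h : op μ G f s - op μ G f t = pairing μ (G.curry s - G.curry t) f := by
    simp [op_apply]
  rw [h, dist_eq_norm]
  have h2 := (pairing_sq_le μ (G.curry s - G.curry t) f).trans
    (mul_le_of_le_one_right (pairing_self_nonneg μ _) hf)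
  have h3 := h2.trans (pairing_self_le μ _)
  have h4 := Real.abs_le_sqrt h3
  rwa [Real.sqrt_mul measureReal_nonneg, Real.sqrt_sq (norm_nonneg _)] at h4

/-- The image under `op` of a sequence bounded in mean square has a uniformly convergent
subsequence. -/
lemma exists_tendsto_subseq {f : ℕ → C(K, ℝ)} (hf : ∀ k, pairing μ (f k) (f k) ≤ 1) :
    ∃ (g : C(K, ℝ)) (φ : ℕ → ℕ), StrictMono φ ∧
      Tendsto (fun k => op μ G (f (φ k))) atTop (𝓝 g) := by
  let e := BoundedContinuousFunction.mkOfCompact (α := K) (β := ℝ)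
  set R := √(μ.real univ * ‖G‖ ^ 2) with hR
  let A : Set (BoundedContinuousFunction K ℝ) := range fun k => e (op μ G (f k))
  have hA : IsCompact (closure A) := by
    refine BoundedContinuousFunction.arzela_ascoli (Metric.closedBall (0 : ℝ) R)
      (isCompact_closedBall _ _) A ?_ ?_
    · rintro _ x ⟨k, rfl⟩
      rw [mem_closedBall_zero_iff]
      refine ((op μ G (f k)).norm_coe_le_norm x).trans (Real.le_sqrt_of_sq_le ?_)
      exact (norm_op_sq_le μ G _).trans (mul_le_of_le_one_right (by positivity) (hf k))
    · refine fun t => Metric.equicontinuousAt_of_continuity_modulus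
        (fun s => √(μ.real univ) * dist (G.curry t) (G.curry s)) ?_ _ ?_
      · have hc : Continuous fun s => √(μ.real univ) * dist (G.curry t) (G.curry s) :=
          continuous_const.mul (continuous_const.dist G.curry.continuous)
        simpa using hc.tendsto t
      · refine Eventually.of_forall ?_
        rintro s ⟨_, k, rfl⟩
        exact abs_op_sub_le μ G (hf k) t s
  obtain ⟨g, -, φ, hφ, hg⟩ := hA.tendsto_subseq (x := fun k => e (op μ G (f k)))
    fun k => subset_closure ⟨k, rfl⟩
  refine ⟨g.toContinuousMap, φ, hφ, ?_⟩
  rw [tendsto_iff_dist_tendsto_zero] at hg ⊢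
  refine hg.congr fun k => ?_
  simp only [Function.comp, e]
  rw [← BoundedContinuousFunction.dist_mkOfCompact]
  rfl

/-- The largest eigenvalue of a nonzero positive semidefinite operator with continuous symmetric
kernel exists and is given by the variational principle. -/
theorem exists_max_eigenvalue (hG : ∀ s t, G (s, t) = G (t, s))
    (hpos : ∀ f, 0 ≤ pairing μ (op μ G f) f) (hne : ∃ f, 0 < pairing μ (op μ G f) f) :
    ∃ M : ℝ, 0 < M ∧ (∃ g : C(K, ℝ), g ≠ 0 ∧ op μ G g = M • g) ∧
      (∀ f, pairing μ (op μ G f) f ≤ M * pairing μ f f) ∧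
      (∀ f, pairing μ (op μ G f) (op μ G f) ≤ M * pairing μ (op μ G f) f) := by
  set T := op μ G with hT
  have hbound : ∀ f, pairing μ (T f) f ≤ μ.real univ * ‖G‖ * pairing μ f f := by
    intro f
    have h1 := pairing_sq_le μ (T f) f
    have h2 := (pairing_self_le μ (T f)).trans
      (mul_le_mul_of_nonneg_left (norm_op_sq_le μ G f) measureReal_nonneg)
    have h3 := pairing_self_nonneg μ f
    refine abs_le_of_sq_le_sq' ?_ (by positivity) |>.2
    calc _ ≤ _ := h1
      _ ≤ _ := mul_le_mul_of_nonneg_right h2 h3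
      _ = _ := by ring
  let S : Set ℝ := {m | ∃ f, pairing μ f f = 1 ∧ pairing μ (T f) f = m}
  have hposself : ∀ f, 0 < pairing μ (T f) f → 0 < pairing μ f f := by
    intro f hf
    refine (pairing_self_nonneg μ f).lt_of_ne fun h => ?_
    have := hbound f
    rw [← h] at this
    linarith
  have hnorm : ∀ f, 0 < pairing μ f f → pairing μ (T f) f / pairing μ f f ∈ S := by
    intro f hf
    have hs : √(pairing μ f f) * √(pairing μ f f) = pairing μ f f := Real.mul_self_sqrt hf.le
    refine ⟨(√(pairing μ f f))⁻¹ • f, ?_, ?_⟩ <;>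
    simp only [map_smul, LinearMap.smul_apply, smul_eq_mul, ← mul_assoc, ← mul_inv, hs]
    · exact inv_mul_cancel₀ hf.ne'
    · rw [inv_mul_eq_div]
  have hSb : BddAbove S := ⟨μ.real univ * ‖G‖, by
    rintro _ ⟨f, hf, rfl⟩
    simpa [hf] using hbound f⟩
  obtain ⟨f₀, hf₀⟩ := hne
  have hf₀' := hposself f₀ hf₀
  have hSne : S.Nonempty := ⟨_, hnorm f₀ hf₀'⟩
  set M := sSup S with hM
  have hM0 : 0 < M := (div_pos hf₀ hf₀').trans_le (le_csSup hSb (hnorm f₀ hf₀'))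
  have hray : ∀ f, pairing μ (T f) f ≤ M * pairing μ f f := by
    intro f
    rcases (pairing_self_nonneg μ f).eq_or_lt with h | h
    · have := hbound f
      rw [← h] at this ⊢
      linarith
    · exact (div_le_iff₀ h).1 (le_csSup hSb (hnorm f h))
  -- Cauchy–Schwarz for the semidefinite form `⟨T·, ·⟩` at `f` and `Tf`, followed by the Rayleigh
  -- bound at `Tf`; one factor `⟨Tf, Tf⟩` cancels.
  have hsq : ∀ f, pairing μ (T f) (T f) ≤ M * pairing μ (T f) f := by
    intro f
    have h1 := LinearMap.BilinForm.apply_sq_le_of_symm (pairing μ ∘ₗ T) hpos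
      ⟨fun f g => by
        simpa [pairing_comm μ _ f] using (pairing_op_comm μ G hG f g)⟩ f (T f)
    simp only [LinearMap.comp_apply] at h1
    have h2 := hray (T f)
    have h3 := pairing_self_nonneg μ (T f)
    have h4 := hpos f
    rcases h3.eq_or_lt with h | h
    · rw [← h]; positivity
    · have : pairing μ (T f) (T f) * pairing μ (T f) (T f) ≤
          (M * pairing μ (T f) f) * pairing μ (T f) (T f) := by nlinarith
      exact le_of_mul_le_mul_right this h
  refine ⟨M, hM0, ?_, hray, hsq⟩
  obtain ⟨u, -, hu, huS⟩ := exists_seq_tendsto_sSup hSne hSb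
  choose f hf1 hfu using huS
  obtain ⟨g, φ, hφ, hg⟩ := exists_tendsto_subseq μ G (f := f) fun k => (hf1 k).le
  have hlim : Tendsto (fun k => pairing μ (T (f (φ k))) (f (φ k))) atTop (𝓝 M) := by
    refine (hu.comp hφ.tendsto_atTop).congr fun k => (hfu (φ k)).symm
  -- For a normalized maximizing sequence, `hsq` gives `‖Tf - Mf‖₂² ≤ M (M - ⟨Tf, f⟩) → 0`. One more
  -- application of `T` makes the convergence uniform.
  have hdiff : Tendsto (fun k => T (T (f (φ k)) - M • f (φ k))) atTop (𝓝 0) := by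
    rw [tendsto_zero_iff_norm_tendsto_zero]
    have hsq0 : Tendsto (fun k => ‖T (T (f (φ k)) - M • f (φ k))‖ ^ 2) atTop (𝓝 0) := by
      refine squeeze_zero (g := fun k => μ.real univ * ‖G‖ ^ 2 *
        (M * (M - pairing μ (T (f (φ k))) (f (φ k))))) (fun k => sq_nonneg _) (fun k => ?_) ?_
      · refine (norm_op_sq_le μ G _).trans (mul_le_mul_of_nonneg_left ?_ (by positivity))
        have h1 := hsq (f (φ k))
        have h2 := hf1 (φ k)
        simp only [map_sub, LinearMap.sub_apply, map_smul, LinearMap.smul_apply, smul_eq_mul]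
        rw [h2, pairing_comm μ (f (φ k)) (T (f (φ k)))]
        linarith
      · have := ((tendsto_const_nhds (x := M)).sub hlim).const_mul M |>.const_mul
          (μ.real univ * ‖G‖ ^ 2)
        simpa using this
    simpa using hsq0.sqrt
  refine ⟨g, ?_, ?_⟩
  -- If the limit were zero, `⟨Tf, f⟩` would tend to `0` along the subsequence instead of to `M >
  -- 0`.
  · rintro rfl
    have h1 : Tendsto (fun k => pairing μ (T (f (φ k))) (T (f (φ k)))) atTop (𝓝 0) := by
      refine squeeze_zero (fun k => pairing_self_nonneg μ _) (fun k => pairing_self_le μ _) ?_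
      have := (hg.norm.pow 2).const_mul (μ.real univ)
      simpa using this
    have h2 : Tendsto (fun k => pairing μ (T (f (φ k))) (f (φ k)) ^ 2) atTop (𝓝 0) := by
      refine squeeze_zero (fun k => sq_nonneg _) (fun k => ?_) h1
      simpa [hf1] using pairing_sq_le μ (T (f (φ k))) (f (φ k))
    have := tendsto_nhds_unique h2 (hlim.pow 2)
    exact hM0.ne' (pow_eq_zero_iff two_ne_zero |>.1 this.symm)
  · have h1 : Tendsto (fun k => T (T (f (φ k)))) atTop (𝓝 (T g)) :=
      ((continuous_op μ G).tendsto g).comp hg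
    have h2 := hdiff.add (hg.const_smul M)
    simp only [map_sub, map_smul, zero_add, ← hT, sub_add_cancel] at h2
    exact tendsto_nhds_unique h1 h2

end ContinuousKernel

/-! ### Derivative chains and repeated integration by parts -/

/-- `φ 0, φ 1, …, φ N` are successive derivatives on `[-1, 1]`, the last one continuous. -/
structure IsDerivChain (N : ℕ) (φ : ℕ → ℝ → ℝ) : Prop where
  hasDeriv : ∀ j < N, ∀ t ∈ Icc (-1 : ℝ) 1,
    HasDerivWithinAt (φ j) (φ (j + 1) t) (Icc (-1) 1) t
  continuousOn_last : ContinuousOn (φ N) (Icc (-1) 1)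

namespace IsDerivChain

variable {N : ℕ} {φ q : ℕ → ℝ → ℝ}

lemma continuousOn (h : IsDerivChain N φ) {j : ℕ} (hj : j ≤ N) : ContinuousOn (φ j) (Icc (-1) 1) := by
  rcases hj.lt_or_eq with hj | rfl
  · exact fun t ht => (h.hasDeriv j hj t ht).continuousWithinAt
  · exact h.continuousOn_last

lemma shift {m : ℕ} (h : IsDerivChain (m + N) φ) : IsDerivChain N fun j => φ (m + j) :=
  ⟨fun j hj t ht => h.hasDeriv (m + j) (by omega) t ht, h.continuousOn_last⟩

lemma of_le {m : ℕ} (h : IsDerivChain N φ) (hm : m ≤ N) : IsDerivChain m φ :=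
  ⟨fun j hj t ht => h.hasDeriv j (by omega) t ht, h.continuousOn hm⟩

lemma of_polynomial (N : ℕ) (P : ℝ[X]) : IsDerivChain N fun j t => (derivative^[j] P).eval t := by
  refine ⟨fun j _ t _ => ?_, (Polynomial.continuous _).continuousOn⟩
  rw [Function.iterate_succ_apply']
  exact (Polynomial.hasDerivAt _ t).hasDerivWithinAt

lemma of_contDiffOn {ψ : ℝ → ℝ} (h : ContDiffOn ℝ N ψ (Icc (-1) 1)) :
    IsDerivChain N fun j => iteratedDerivWithin j ψ (Icc (-1) 1) := by
  have hu : UniqueDiffOn ℝ (Icc (-1 : ℝ) 1) := uniqueDiffOn_Icc (by norm_num)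
  refine ⟨fun j hj t ht => ?_, h.continuousOn_iteratedDerivWithin le_rfl hu⟩
  have := (h.differentiableOn_iteratedDerivWithin (m := j) (by exact_mod_cast hj) hu t
    ht).hasDerivWithinAt
  rwa [← iteratedDerivWithin_succ] at this

lemma iteratedDerivWithin_eq (h : IsDerivChain N φ) {j : ℕ} (hj : j ≤ N) :
    EqOn (iteratedDerivWithin j (φ 0) (Icc (-1) 1)) (φ j) (Icc (-1) 1) := by
  have hu : UniqueDiffOn ℝ (Icc (-1 : ℝ) 1) := uniqueDiffOn_Icc (by norm_num)
  induction j with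
  | zero => intro t _; simp
  | succ j ih =>
    intro t ht
    rw [iteratedDerivWithin_succ, derivWithin_congr (ih (by omega)) (ih (by omega) ht)]
    exact (h.hasDeriv j (by omega) t ht).derivWithin (hu t ht)

lemma contDiffOn (h : IsDerivChain N φ) : ContDiffOn ℝ N (φ 0) (Icc (-1) 1) := by
  have hu : UniqueDiffOn ℝ (Icc (-1 : ℝ) 1) := uniqueDiffOn_Icc (by norm_num)
  refine contDiffOn_of_continuousOn_differentiableOn_deriv (n := N) (fun m hm => ?_) fun m hm => ?_
  · have hm' : m ≤ N := by exact_mod_cast hm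
    exact (h.continuousOn hm').congr (h.iteratedDerivWithin_eq hm')
  · have hm' : m < N := by exact_mod_cast hm
    exact DifferentiableOn.congr (fun t ht => (h.hasDeriv m hm' t ht).differentiableWithinAt)
      (h.iteratedDerivWithin_eq hm'.le)

/-- The boundary term in `N`-fold integration by parts. -/
def bdry (N : ℕ) (q φ : ℕ → ℝ → ℝ) (s : ℝ) : ℝ :=
  ∑ j ∈ Finset.range N, (-1) ^ j * (q j s * φ (N - 1 - j) s)

lemma hasDerivWithinAt_bdry (hq : IsDerivChain N q) (hφ : IsDerivChain N φ) {t : ℝ}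
    (ht : t ∈ Icc (-1 : ℝ) 1) :
    HasDerivWithinAt (bdry N q φ) (q 0 t * φ N t - (-1) ^ N * (q N t * φ 0 t)) (Icc (-1) 1) t := by
  have h : HasDerivWithinAt (bdry N q φ)
      (∑ j ∈ Finset.range N, (-1) ^ j * (q (j + 1) t * φ (N - 1 - j) t +
        q j t * φ (N - 1 - j + 1) t)) (Icc (-1) 1) t :=
    HasDerivWithinAt.fun_sum fun j hj => by
      have hj' := Finset.mem_range.1 hj
      exact ((hq.hasDeriv j hj' t ht).mul (hφ.hasDeriv _ (by omega) t ht)).const_mul _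
  convert h using 1
  -- The product rule produces an alternating sum that telescopes to its two end terms.
  have := Finset.sum_range_sub' (fun j => (-1 : ℝ) ^ j * (q j t * φ (N - j) t)) N
  simp only [pow_zero, one_mul, Nat.sub_zero, Nat.sub_self] at this
  rw [← this]
  refine Finset.sum_congr rfl fun j hj => ?_
  have hj' := Finset.mem_range.1 hj
  rw [show N - (j + 1) = N - 1 - j by omega, show N - j = N - 1 - j + 1 by omega, pow_succ]
  ring

lemma continuousOn_bdry (hq : IsDerivChain N q) (hφ : IsDerivChain N φ) :
    ContinuousOn (bdry N q φ) (Icc (-1) 1) :=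
  fun _ ht => (hasDerivWithinAt_bdry hq hφ ht).continuousWithinAt

theorem integral_eq_bdry_sub (hq : IsDerivChain N q) (hφ : IsDerivChain N φ) {a b : ℝ}
    (ha : -1 ≤ a) (hab : a ≤ b) (hb : b ≤ 1) :
    ∫ s in a..b, (q 0 s * φ N s - (-1) ^ N * (q N s * φ 0 s)) = bdry N q φ b - bdry N q φ a := by
  have hsub : Icc a b ⊆ Icc (-1) 1 := Icc_subset_Icc ha hb
  refine intervalIntegral.integral_eq_sub_of_hasDerivAt_of_le hab
    ((continuousOn_bdry hq hφ).mono hsub) (fun s hs => ?_) ?_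
  · exact (hasDerivWithinAt_bdry hq hφ (hsub (Ioo_subset_Icc_self hs))).hasDerivAt
      (Icc_mem_nhds (ha.trans_lt hs.1) (hs.2.trans_le hb))
  · refine ContinuousOn.intervalIntegrable_of_Icc hab (ContinuousOn.mono ?_ hsub)
    exact ((hq.continuousOn (Nat.zero_le _)).mul (hφ.continuousOn le_rfl)).sub
      (continuousOn_const.mul ((hq.continuousOn le_rfl).mul (hφ.continuousOn (Nat.zero_le _))))

end IsDerivChain

/-- A chain of `2n` derivatives satisfying the Dirichlet boundary conditions of order `n`. -/
structure IsDirichletChain (n : ℕ) (φ : ℕ → ℝ → ℝ) : Prop extends IsDerivChain (2 * n) φ where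
  left : ∀ j < n, φ j (-1) = 0
  right : ∀ j < n, φ j 1 = 0

namespace IsDirichletChain

variable {n : ℕ} {φ : ℕ → ℝ → ℝ}

/-- Each boundary term pairs orders `j` and `2n - 1 - j`, and one of them is below `n`. -/
lemma bdry_eq_zero {q : ℕ → ℝ → ℝ} {s : ℝ} (hq : ∀ j < n, q j s = 0) (hφ : ∀ j < n, φ j s = 0) :
    IsDerivChain.bdry (2 * n) q φ s = 0 := by
  refine Finset.sum_eq_zero fun j hj => ?_
  have hj' := Finset.mem_range.1 hj
  by_cases h : j < n
  · rw [hq j h]; ring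
  · rw [hφ (2 * n - 1 - j) (by omega)]; ring

/-- The energy identity. -/
theorem integral_mul_last (h : IsDirichletChain n φ) :
    ∫ s in (-1 : ℝ)..1, φ 0 s * ((-1) ^ n * φ (2 * n) s) = ∫ s in (-1 : ℝ)..1, φ n s ^ 2 := by
  have h1 : IsDerivChain n φ := h.toIsDerivChain.of_le (by omega)
  -- Integrating by parts between the lower and upper halves of the chain moves exactly `n`
  -- derivatives.
  have h2 : IsDerivChain n fun j => φ (n + j) :=
    IsDerivChain.shift (by simpa [two_mul] using h.toIsDerivChain)
  have h3 := IsDerivChain.integral_eq_bdry_sub h1 h2 le_rfl (by norm_num) le_rfl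
  have hz : ∀ s, (∀ j < n, φ j s = 0) → IsDerivChain.bdry n φ (fun j => φ (n + j)) s = 0 := by
    intro s hs
    refine Finset.sum_eq_zero fun j hj => ?_
    rw [hs j (Finset.mem_range.1 hj)]; ring
  rw [hz _ h.left, hz _ h.right, sub_zero] at h3
  have hc : ∀ j ≤ 2 * n, ∀ k ≤ 2 * n,
      IntervalIntegrable (fun s => φ j s * φ k s) volume (-1) 1 := fun j hj k hk =>
    ((h.continuousOn hj).mul (h.continuousOn hk)).intervalIntegrable_of_Icc (by norm_num)
  simp only [add_zero, ← two_mul] at h3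
  rw [intervalIntegral.integral_sub (hc _ (by omega) _ le_rfl)
    ((hc n (by omega) n (by omega)).const_mul _), intervalIntegral.integral_const_mul,
    sub_eq_zero] at h3
  simp only [mul_left_comm _ ((-1 : ℝ) ^ n), intervalIntegral.integral_const_mul, h3, pow_two]
  rw [← mul_assoc, ← mul_pow]
  norm_num

/-- Representation of a function by a Green's function given piecewise by polynomials. -/
theorem integral_add_integral (hn : 1 ≤ n) (h : IsDirichletChain n φ) {t : ℝ}
    (ht : t ∈ Icc (-1 : ℝ) 1) {p q : ℝ[X]} (hp : p.degree < (2 * n : ℕ))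
    (hq : q.degree < (2 * n : ℕ))
    (hpl : ∀ j < n, (derivative^[j] p).eval (-1) = 0)
    (hqr : ∀ j < n, (derivative^[j] q).eval 1 = 0)
    (hpq : p - q = C ((-1) ^ (n + 1) / ((2 * n - 1).factorial : ℝ)) * (X - C t) ^ (2 * n - 1)) :
    (∫ s in (-1 : ℝ)..t, p.eval s * φ (2 * n) s) + (∫ s in t..1, q.eval s * φ (2 * n) s) =
      (-1) ^ n * φ 0 t := by
  have key : ∀ (r : ℝ[X]), r.degree < (2 * n : ℕ) → ∀ a b : ℝ, -1 ≤ a → a ≤ b → b ≤ 1 →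
      ∫ s in a..b, r.eval s * φ (2 * n) s =
        IsDerivChain.bdry (2 * n) (fun j t => (derivative^[j] r).eval t) φ b -
          IsDerivChain.bdry (2 * n) (fun j t => (derivative^[j] r).eval t) φ a := by
    intro r hr a b ha hab hb
    rw [← (IsDerivChain.of_polynomial (2 * n) r).integral_eq_bdry_sub h.toIsDerivChain ha hab hb]
    simp [iterate_derivative_eq_zero_of_degree_lt hr]
  rw [key p hp _ _ le_rfl ht.1 ht.2, key q hq _ _ ht.1 ht.2 le_rfl,
    bdry_eq_zero hpl h.left, bdry_eq_zero hqr h.right]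
  have hd : ∀ j, (derivative^[j] p).eval t - (derivative^[j] q).eval t =
      (derivative^[j] (p - q)).eval t := fun j => by rw [iterate_derivative_sub, eval_sub]
  have : IsDerivChain.bdry (2 * n) (fun j t => (derivative^[j] p).eval t) φ t -
      IsDerivChain.bdry (2 * n) (fun j t => (derivative^[j] q).eval t) φ t =
      ∑ j ∈ Finset.range (2 * n), (-1) ^ j * ((derivative^[j] (p - q)).eval t *
        φ (2 * n - 1 - j) t) := by
    unfold IsDerivChain.bdry
    rw [← Finset.sum_sub_distrib]
    refine Finset.sum_congr rfl fun j _ => ?_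
    rw [← hd]; ring
  -- The difference `p - q` vanishes to order `2n - 1` at `t`, so only the jump of the derivative of
  -- order `2n - 1` contributes.
  rw [sub_zero, zero_sub, ← sub_eq_add_neg, this, Finset.sum_eq_single (2 * n - 1)]
  · rw [hpq, iterate_derivative_C_mul, iterate_derivative_X_sub_pow_self]
    have hf : ((2 * n - 1).factorial : ℝ) ≠ 0 := by positivity
    simp only [eval_mul, eval_C, eval_natCast, Nat.sub_self]
    rw [div_mul_cancel₀ _ hf, ← mul_assoc, ← pow_add,
      show 2 * n - 1 + (n + 1) = 2 * n + n by omega, pow_add, pow_mul]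
    norm_num
  · intro j hj hne
    have hj' := Finset.mem_range.1 hj
    rw [hpq, iterate_derivative_C_mul, iterate_derivative_X_sub_pow]
    simp [show 2 * n - 1 - j ≠ 0 by omega]
  · intro hj
    simp only [Finset.mem_range, not_lt] at hj
    omega

end IsDirichletChain

/-! ### Hermite interpolation and solvability -/

/-- Two-point Hermite interpolation. -/
theorem exists_hermite_interpolant (n : ℕ) (a b : ℕ → ℝ) :
    ∃ P : ℝ[X], P.degree < (2 * n : ℕ) ∧ ∀ j < n,
      (derivative^[j] P).eval (-1) = a j ∧ (derivative^[j] P).eval 1 = b j := by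
  let ev (x : ℝ) : ℝ[X] →ₗ[ℝ] (Fin n → ℝ) :=
    LinearMap.pi fun j => (leval x) ∘ₗ (derivative ^ (j : ℕ))
  have hev : ∀ x P j, ev x P j = (derivative^[(j : ℕ)] P).eval x := fun x P j => by
    simp [ev, leval, Module.End.pow_apply]
  let L : degreeLT ℝ (2 * n) →ₗ[ℝ] (Fin n → ℝ) × (Fin n → ℝ) :=
    ((ev (-1)).prod (ev 1)) ∘ₗ (degreeLT ℝ (2 * n)).subtype
  have hfin : Module.finrank ℝ (degreeLT ℝ (2 * n)) =
      Module.finrank ℝ ((Fin n → ℝ) × (Fin n → ℝ)) := by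
    rw [(degreeLTEquiv ℝ (2 * n)).finrank_eq]
    simp [two_mul]
  have : FiniteDimensional ℝ (degreeLT ℝ (2 * n)) :=
    Module.Finite.equiv (degreeLTEquiv ℝ (2 * n)).symm
  have hdvd : ∀ (x : ℝ) (P : ℝ[X]), ev x P = 0 → (X - C x) ^ n ∣ P := by
    intro x P hP
    rcases eq_or_ne P 0 with rfl | h0
    · simp
    rcases n.eq_zero_or_pos with rfl | hn
    · simp
    rw [← le_rootMultiplicity_iff h0]
    have := (lt_rootMultiplicity_iff_isRoot_iterate_derivative (n := n - 1) (t := x) h0).2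
      fun m hm => by
        have := congrFun hP ⟨m, by omega⟩
        rwa [hev] at this
    omega
  -- A polynomial in the kernel is divisible by `(X + 1)ⁿ (X - 1)ⁿ`, of degree `2n`, hence is zero.
  -- Surjectivity then follows because the dimensions agree.
  have hinj : Function.Injective L := by
    rw [← LinearMap.ker_eq_bot, LinearMap.ker_eq_bot']
    rintro ⟨P, hPd⟩ hP
    have h1 : ev (-1) P = 0 := congrArg Prod.fst hP
    have h2 : ev 1 P = 0 := congrArg Prod.snd hP
    have hco : IsCoprime ((X - C (-1 : ℝ)) ^ n) ((X - C (1 : ℝ)) ^ n) :=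
      (isCoprime_X_sub_C_of_isUnit_sub (by norm_num)).pow
    have hd := hco.mul_dvd (hdvd _ P h1) (hdvd _ P h2)
    refine Subtype.ext ?_
    refine eq_zero_of_dvd_of_degree_lt hd ((mem_degreeLT.1 hPd).trans_le ?_)
    rw [degree_mul, degree_pow, degree_pow, degree_X_sub_C, degree_X_sub_C, nsmul_one]
    exact_mod_cast (by omega : 2 * n ≤ n + n)
  obtain ⟨P, hP⟩ := (LinearMap.injective_iff_surjective_of_finrank_eq_finrank hfin).1 hinj
    (fun j => a j, fun j => b j)
  refine ⟨P, mem_degreeLT.1 P.2, fun j hj => ⟨?_, ?_⟩⟩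
  · rw [← hev (-1) P ⟨j, hj⟩]; exact congrFun (congrArg Prod.fst hP) ⟨j, hj⟩
  · rw [← hev 1 P ⟨j, hj⟩]; exact congrFun (congrArg Prod.snd hP) ⟨j, hj⟩

/-- Iterated primitives. -/
def iteratedPrimitive (f : ℝ → ℝ) : ℕ → ℝ → ℝ
  | 0 => f
  | m + 1 => fun x => ∫ s in (0 : ℝ)..x, iteratedPrimitive f m s

lemma continuous_iteratedPrimitive {f : ℝ → ℝ} (hf : Continuous f) :
    ∀ m, Continuous (iteratedPrimitive f m)
  | 0 => hf
  | m + 1 => intervalIntegral.continuous_primitive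
      (fun _ _ => (continuous_iteratedPrimitive hf m).intervalIntegrable _ _) 0

lemma hasDerivAt_iteratedPrimitive {f : ℝ → ℝ} (hf : Continuous f) (m : ℕ) (x : ℝ) :
    HasDerivAt (iteratedPrimitive f (m + 1)) (iteratedPrimitive f m x) x :=
  (continuous_iteratedPrimitive hf m).integral_hasStrictDerivAt 0 x |>.hasDerivAt

/-- The Dirichlet problem `u^{(2n)} = f` is solvable. -/
theorem exists_isDirichletChain (n : ℕ) {f : ℝ → ℝ} (hf : Continuous f) :
    ∃ φ, IsDirichletChain n φ ∧ φ (2 * n) = f := by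
  -- Subtracting the interpolant of the boundary data of the iterated primitive enforces the
  -- boundary conditions; its degree is below `2n`, so the top derivative is unchanged.
  obtain ⟨P, hP, hPj⟩ := exists_hermite_interpolant n
    (fun j => iteratedPrimitive f (2 * n - j) (-1)) (fun j => iteratedPrimitive f (2 * n - j) 1)
  refine ⟨fun j t => iteratedPrimitive f (2 * n - j) t - (derivative^[j] P).eval t,
    ⟨⟨fun j hj t ht => ?_, ?_⟩, fun j hj => ?_, fun j hj => ?_⟩, ?_⟩
  · have h1 := hasDerivAt_iteratedPrimitive hf (2 * n - (j + 1)) t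
    rw [show 2 * n - (j + 1) + 1 = 2 * n - j by omega] at h1
    exact h1.hasDerivWithinAt.sub ((IsDerivChain.of_polynomial (2 * n) P).hasDeriv j hj t ht)
  · exact ((continuous_iteratedPrimitive hf _).sub (Polynomial.continuous _)).continuousOn
  · simp [(hPj j hj).1]
  · simp [(hPj j hj).2]
  · funext t
    simp [iterate_derivative_eq_zero_of_degree_lt hP, iteratedPrimitive]

/-! ### Beta integrals and Boggio's Green function -/

theorem integral_pow_mul_one_sub_pow (a b : ℕ) :
    ∫ x in (0 : ℝ)..1, x ^ a * (1 - x) ^ b =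
      (a.factorial * b.factorial : ℝ) / ((a + b + 1).factorial : ℝ) := by
  induction b generalizing a with
  | zero =>
    simp [Nat.factorial_succ]
    field_simp
  | succ b ih =>
    have h : ∀ x : ℝ, x ^ a * (1 - x) ^ (b + 1) = x ^ a * (1 - x) ^ b - x ^ (a + 1) * (1 - x) ^ b :=
      fun x => by ring
    simp only [h]
    rw [intervalIntegral.integral_sub (Continuous.intervalIntegrable (by fun_prop) _ _)
      (Continuous.intervalIntegrable (by fun_prop) _ _), ih, ih,
      show a + 1 + b + 1 = (a + b + 1) + 1 by ring, show a + (b + 1) + 1 = (a + b + 1) + 1 by ring]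
    simp only [Nat.factorial_succ]
    push_cast
    field_simp
    ring

theorem integral_one_sub_sq_pow (m : ℕ) :
    ∫ x in (-1 : ℝ)..1, (1 - x ^ 2) ^ m =
      2 * 4 ^ m * (m.factorial : ℝ) ^ 2 / ((2 * m + 1).factorial : ℝ) := by
  have h := intervalIntegral.smul_integral_comp_mul_add (a := 0) (b := 1)
    (fun x : ℝ => (1 - x ^ 2) ^ m) 2 (-1)
  norm_num at h
  rw [← h]
  have h2 : ∀ x : ℝ, (1 - (2 * x + -1) ^ 2) ^ m = 4 ^ m * (x ^ m * (1 - x) ^ m) := fun x => by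
    rw [← mul_pow, ← mul_pow]; ring
  simp only [h2, intervalIntegral.integral_const_mul, integral_pow_mul_one_sub_pow]
  rw [two_mul m]
  ring

/-- The polynomial expression for `∫₀ᵉ x ^ m (2d + x) ^ m dx`. -/
def greenProfile {A : Type*} [CommRing A] [Algebra ℝ A] (m : ℕ) (d e : A) : A :=
  ∑ j ∈ Finset.range (m + 1),
    algebraMap ℝ A ((m.choose j : ℝ) / ((2 * m + 1 - j : ℕ) : ℝ)) * ((2 * d) ^ j * e ^ (2 * m + 1 - j))

/-- Naturality lets the same formula serve as a number and as a polynomial in `s`, with evaluation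
passing between the two. -/
lemma map_greenProfile {A B : Type*} [CommRing A] [Algebra ℝ A] [CommRing B] [Algebra ℝ B]
    (f : A →ₐ[ℝ] B) (m : ℕ) (d e : A) : f (greenProfile m d e) = greenProfile m (f d) (f e) := by
  have h2 : f 2 = 2 := map_ofNat f 2
  simp [greenProfile, map_sum, h2]

lemma greenProfile_nonneg (m : ℕ) {d e : ℝ} (hd : 0 ≤ d) (he : 0 ≤ e) : 0 ≤ greenProfile m d e :=
  Finset.sum_nonneg fun j _ => by simp only [Algebra.algebraMap_self, RingHom.id_apply]; positivity

lemma greenProfile_eq_integral (m : ℕ) (d e : ℝ) :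
    greenProfile m d e = ∫ x in (0 : ℝ)..e, x ^ m * (2 * d + x) ^ m := by
  have h : ∀ x : ℝ, x ^ m * (2 * d + x) ^ m =
      ∑ j ∈ Finset.range (m + 1), (m.choose j : ℝ) * (2 * d) ^ j * x ^ (2 * m - j) := by
    intro x
    rw [add_pow, Finset.mul_sum]
    refine Finset.sum_congr rfl fun j hj => ?_
    have hj' : j ≤ m := Finset.mem_range_succ_iff.1 hj
    rw [show 2 * m - j = m + (m - j) by omega, pow_add]
    ring
  simp only [h]
  rw [intervalIntegral.integral_finsetSum
    fun j _ => Continuous.intervalIntegrable (by fun_prop) _ _]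
  refine Finset.sum_congr rfl fun j hj => ?_
  have hj' : j ≤ m := Finset.mem_range_succ_iff.1 hj
  rw [intervalIntegral.integral_const_mul, integral_pow,
    show 2 * m + 1 - j = (2 * m - j) + 1 by omega]
  simp
  ring

/-- Shifting the variable by `2d` gives both profiles the same integrand; what remains is minus the
integral over `[-2d, 0]`, a Beta integral. -/
lemma greenProfile_sub (m : ℕ) (d e : ℝ) :
    greenProfile m d e - greenProfile m (-d) (e + 2 * d) =
      (-1) ^ (m + 1) * (2 * d) ^ (2 * m + 1) *
        ((m.factorial : ℝ) ^ 2 / ((2 * m + 1).factorial : ℝ)) := by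
  simp only [greenProfile_eq_integral]
  have h1 := intervalIntegral.integral_comp_add_right (a := -(2 * d)) (b := e)
    (fun x => x ^ m * (2 * -d + x) ^ m) (2 * d)
  rw [neg_add_cancel] at h1
  have h2 : ∀ x : ℝ, (x + 2 * d) ^ m * (2 * -d + (x + 2 * d)) ^ m = x ^ m * (2 * d + x) ^ m :=
    fun x => by rw [← mul_pow, ← mul_pow]; ring
  simp only [h2] at h1
  have hi : ∀ a b : ℝ, IntervalIntegrable (fun x => x ^ m * (2 * d + x) ^ m) volume a b :=
    fun a b => Continuous.intervalIntegrable (by fun_prop) _ _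
  rw [← h1, ← intervalIntegral.integral_add_adjacent_intervals (hi (-(2 * d)) 0) (hi 0 e),
    sub_add_cancel_right]
  have h3 := intervalIntegral.smul_integral_comp_mul_add (a := 0) (b := 1)
    (fun x : ℝ => x ^ m * (2 * d + x) ^ m) (2 * d) (-(2 * d))
  have h4 : ∀ x : ℝ, (2 * d * x + -(2 * d)) ^ m * (2 * d + (2 * d * x + -(2 * d))) ^ m =
      ((-1) ^ m * (2 * d) ^ (2 * m)) * (x ^ m * (1 - x) ^ m) := fun x => by
    rw [pow_mul, ← mul_pow, ← mul_pow, ← mul_pow, ← mul_pow]; ring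
  simp only [h4, mul_zero, zero_add, mul_one, add_neg_cancel] at h3
  rw [← h3, intervalIntegral.integral_const_mul, integral_pow_mul_one_sub_pow, smul_eq_mul,
    ← two_mul m]
  ring

/-- Boggio's Green function of `(-1) ^ (m + 1) D ^ (2m + 2)` on `[-1, 1]` with Dirichlet boundary
conditions. -/
def green (m : ℕ) (t s : ℝ) : ℝ :=
  greenProfile m |t - s| (1 - t * s - |t - s|) / (2 ^ (2 * m + 1) * (m.factorial : ℝ) ^ 2)

lemma green_comm (m : ℕ) (t s : ℝ) : green m t s = green m s t := by
  simp only [green, abs_sub_comm t s, mul_comm t s]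

lemma continuous_green (m : ℕ) : Continuous (Function.uncurry (green m)) := by
  unfold Function.uncurry green greenProfile
  simp only [Algebra.algebraMap_self, RingHom.id_apply]
  fun_prop

lemma continuous_green_right (m : ℕ) (t : ℝ) : Continuous fun s => green m t s :=
  (continuous_green m).uncurry_left t

/-- The upper limit `1 - ts - |t - s|` factors as `(1 - t)(1 + s)` or `(1 + t)(1 - s)`. -/
lemma green_nonneg (m : ℕ) {t s : ℝ} (ht : t ∈ Icc (-1 : ℝ) 1) (hs : s ∈ Icc (-1 : ℝ) 1) :
    0 ≤ green m t s := by
  refine div_nonneg (greenProfile_nonneg m (abs_nonneg _) ?_) (by positivity)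
  obtain ⟨ht1, ht2⟩ := ht
  obtain ⟨hs1, hs2⟩ := hs
  rcases abs_cases (t - s) with ⟨h, -⟩ | ⟨h, -⟩ <;> rw [h] <;> nlinarith

/-- The polynomial to which the Green function restricts on `[-1, t]`. -/
def greenLeft (m : ℕ) (t : ℝ) : ℝ[X] :=
  C (2 ^ (2 * m + 1) * (m.factorial : ℝ) ^ 2)⁻¹ * greenProfile m (C t - X) (C (1 - t) * (X + 1))

/-- The polynomial to which the Green function restricts on `[t, 1]`. -/
def greenRight (m : ℕ) (t : ℝ) : ℝ[X] :=
  C (2 ^ (2 * m + 1) * (m.factorial : ℝ) ^ 2)⁻¹ * greenProfile m (X - C t) (C (-(1 + t)) * (X - 1))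

lemma eval_greenLeft (m : ℕ) (t s : ℝ) : (greenLeft m t).eval s =
    greenProfile m (t - s) ((1 - t) * (s + 1)) / (2 ^ (2 * m + 1) * (m.factorial : ℝ) ^ 2) := by
  have h := map_greenProfile (aeval s) m (C t - X) (C (1 - t) * (X + 1))
  simp only [coe_aeval_eq_eval] at h
  rw [greenLeft, eval_mul, h]
  simp
  ring

lemma eval_greenRight (m : ℕ) (t s : ℝ) : (greenRight m t).eval s =
    greenProfile m (s - t) (-(1 + t) * (s - 1)) / (2 ^ (2 * m + 1) * (m.factorial : ℝ) ^ 2) := by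
  have h := map_greenProfile (aeval s) m (X - C t) (C (-(1 + t)) * (X - 1))
  simp only [coe_aeval_eq_eval] at h
  rw [greenRight, eval_mul, h]
  simp
  ring

lemma green_eq_left (m : ℕ) {t s : ℝ} (h : s ≤ t) : green m t s = (greenLeft m t).eval s := by
  rw [green, eval_greenLeft, abs_of_nonneg (sub_nonneg.2 h)]
  congr 2
  ring

lemma green_eq_right (m : ℕ) {t s : ℝ} (h : t ≤ s) : green m t s = (greenRight m t).eval s := by
  rw [green, eval_greenRight, abs_of_nonpos (sub_nonpos.2 h)]
  congr 2 <;> ring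

lemma degree_greenProfile_lt (m : ℕ) {d e : ℝ[X]} (hd : d.natDegree ≤ 1) (he : e.natDegree ≤ 1)
    (c : ℝ) : (C c * greenProfile m d e).degree < (2 * (m + 1) : ℕ) := by
  have h2 : natDegree (2 * d) ≤ 1 := by
    rw [show (2 : ℝ[X]) = C 2 from (map_ofNat C 2).symm]
    exact (natDegree_C_mul_le _ _).trans hd
  have h : (C c * greenProfile m d e).natDegree ≤ 2 * m + 1 := by
    refine (natDegree_C_mul_le _ _).trans (natDegree_sum_le_of_forall_le _ _ fun j hj => ?_)
    have hj' : j ≤ m := Finset.mem_range_succ_iff.1 hj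
    refine (natDegree_C_mul_le _ _).trans (natDegree_mul_le.trans ?_)
    have h3 := natDegree_pow_le_of_le j h2
    have h4 := natDegree_pow_le_of_le (2 * m + 1 - j) he
    omega
  exact (degree_le_of_natDegree_le h).trans_lt (by exact_mod_cast (by omega))

/-- Every summand contains `e` to a power `2m + 1 - j ≥ m + 1`. This encodes the boundary conditions
of the Green function. -/
lemma pow_dvd_greenProfile (m : ℕ) (d : ℝ[X]) {e f : ℝ[X]} (h : f ∣ e) (c : ℝ) :
    f ^ (m + 1) ∣ C c * greenProfile m d e := by
  refine Dvd.dvd.mul_left (Finset.dvd_sum fun j hj => ?_) _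
  have hj' : j ≤ m := Finset.mem_range_succ_iff.1 hj
  exact Dvd.dvd.mul_left (Dvd.dvd.mul_left ((pow_dvd_pow f (by omega)).trans
    (pow_dvd_pow_of_dvd h _)) _) _

lemma eval_iterate_derivative_of_pow_dvd {n : ℕ} {p : ℝ[X]} {f : ℝ[X]} {a : ℝ} (h : f ^ n ∣ p)
    (hf : f.eval a = 0) {j : ℕ} (hj : j < n) : (derivative^[j] p).eval a = 0 := by
  obtain ⟨r, hr⟩ := pow_sub_dvd_iterate_derivative_of_pow_dvd j h
  rw [hr, eval_mul, eval_pow, hf, zero_pow (by omega), zero_mul]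

lemma degree_greenLeft_lt (m : ℕ) (t : ℝ) : (greenLeft m t).degree < (2 * (m + 1) : ℕ) :=
  degree_greenProfile_lt m (by compute_degree) (by compute_degree) _

lemma degree_greenRight_lt (m : ℕ) (t : ℝ) : (greenRight m t).degree < (2 * (m + 1) : ℕ) :=
  degree_greenProfile_lt m (by compute_degree) (by compute_degree) _

lemma pow_dvd_greenLeft (m : ℕ) (t : ℝ) : (X + 1) ^ (m + 1) ∣ greenLeft m t :=
  pow_dvd_greenProfile m _ (dvd_mul_left _ _) _

lemma pow_dvd_greenRight (m : ℕ) (t : ℝ) : (X - 1) ^ (m + 1) ∣ greenRight m t :=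
  pow_dvd_greenProfile m _ (dvd_mul_left _ _) _

/-- The two upper limits differ by `2(t - s)`, which is the shift in `greenProfile_sub`. The outcome
is the jump condition of a fundamental solution. -/
lemma greenLeft_sub_greenRight (m : ℕ) (t : ℝ) : greenLeft m t - greenRight m t =
    C ((-1) ^ (m + 1 + 1) / ((2 * (m + 1) - 1).factorial : ℝ)) *
      (X - C t) ^ (2 * (m + 1) - 1) := by
  refine Polynomial.funext fun s => ?_
  have h := greenProfile_sub m (t - s) ((1 - t) * (s + 1))
  rw [eval_sub, eval_greenLeft, eval_greenRight, ← sub_div,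
    show s - t = -(t - s) by ring,
    show -(1 + t) * (s - 1) = (1 - t) * (s + 1) + 2 * (t - s) by ring, h]
  simp only [eval_mul, eval_C, eval_pow, eval_sub, eval_X]
  rw [show 2 * (m + 1) - 1 = 2 * m + 1 by omega, show s - t = -(t - s) by ring,
    neg_pow (t - s), mul_pow, Odd.neg_one_pow (⟨m, rfl⟩ : Odd (2 * m + 1)), pow_succ (-1 : ℝ) (m + 1)]
  have hm : (m.factorial : ℝ) ≠ 0 := by positivity
  have hm' : ((2 * m + 1).factorial : ℝ) ≠ 0 := by positivity
  field_simp

/-- Green's representation formula. -/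
theorem integral_green_mul {m : ℕ} {φ : ℕ → ℝ → ℝ} (h : IsDirichletChain (m + 1) φ) {t : ℝ}
    (ht : t ∈ Icc (-1 : ℝ) 1) :
    ∫ s in (-1 : ℝ)..1, green m t s * ((-1) ^ (m + 1) * φ (2 * (m + 1)) s) = φ 0 t := by
  have hrep := h.integral_add_integral (by omega) ht (degree_greenLeft_lt m t)
    (degree_greenRight_lt m t) (fun j hj => eval_iterate_derivative_of_pow_dvd
      (pow_dvd_greenLeft m t) (by simp) hj)
    (fun j hj => eval_iterate_derivative_of_pow_dvd (pow_dvd_greenRight m t) (by simp) hj)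
    (greenLeft_sub_greenRight m t)
  have hl : ∫ s in (-1 : ℝ)..t, (greenLeft m t).eval s * φ (2 * (m + 1)) s =
      ∫ s in (-1 : ℝ)..t, green m t s * φ (2 * (m + 1)) s :=
    intervalIntegral.integral_congr fun s hs => by
      rw [uIcc_of_le ht.1] at hs
      simp only [green_eq_left m hs.2]
  have hr : ∫ s in t..1, (greenRight m t).eval s * φ (2 * (m + 1)) s =
      ∫ s in t..1, green m t s * φ (2 * (m + 1)) s :=
    intervalIntegral.integral_congr fun s hs => by
      rw [uIcc_of_le ht.2] at hs
      simp only [green_eq_right m hs.1]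
  have hg : Continuous fun s => green m t s := continuous_green_right m t
  have hc : ContinuousOn (fun s => green m t s * φ (2 * (m + 1)) s) (Icc (-1) 1) :=
    hg.continuousOn.mul h.continuousOn_last
  rw [hl, hr, intervalIntegral.integral_add_adjacent_intervals
    ((hc.mono (Icc_subset_Icc_right ht.2)).intervalIntegrable_of_Icc ht.1)
    ((hc.mono (Icc_subset_Icc_left ht.1)).intervalIntegrable_of_Icc ht.2)] at hrep
  simp only [mul_left_comm _ ((-1 : ℝ) ^ (m + 1)), intervalIntegral.integral_const_mul, hrep]
  rw [← mul_assoc, ← mul_pow]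
  norm_num

/-! ### The solution operator and its spectrum -/

namespace DirichletGreen

open ContinuousKernel

/-- The interval `[-1, 1]` as a type. -/
abbrev I : Type := Icc (-1 : ℝ) 1

/-- Lebesgue measure on `[-1, 1]`. -/
def ν : Measure I := Measure.comap Subtype.val volume

instance : IsFiniteMeasure ν :=
  ⟨by rw [ν, comap_subtype_coe_apply measurableSet_Icc, image_univ, Subtype.range_coe, Real.volume_Icc]
      exact ENNReal.ofReal_lt_top⟩

/-- Restriction to `[-1, 1]`. -/
def restrict (F : ℝ → ℝ) (hF : ContinuousOn F (Icc (-1) 1)) : C(I, ℝ) :=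
  ⟨fun s => F s, hF.domRestrict⟩

@[simp] lemma restrict_apply (F : ℝ → ℝ) (hF : ContinuousOn F (Icc (-1) 1)) (s : I) :
    restrict F hF s = F s := rfl

lemma integral_eq {f : I → ℝ} {F : ℝ → ℝ} (h : ∀ s : I, f s = F s) :
    ∫ s, f s ∂ν = ∫ s in (-1 : ℝ)..1, F s := by
  rw [intervalIntegral.integral_of_le (by norm_num), ← integral_Icc_eq_integral_Ioc,
    ← integral_subtype_comap measurableSet_Icc]
  exact integral_congr_ae (Eventually.of_forall h)

lemma pairing_eq {f g : C(I, ℝ)} {F H : ℝ → ℝ} (hf : ∀ s : I, f s = F s) (hg : ∀ s : I, g s = H s) :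
    pairing ν f g = ∫ s in (-1 : ℝ)..1, F s * H s :=
  integral_eq fun s => by rw [hf, hg]

lemma eq_zero_of_integral_eq_zero {f : C(I, ℝ)} (hf : ∀ s, 0 ≤ f s) (h : ∫ s, f s ∂ν = 0) :
    f = 0 := by
  have hF : Continuous fun s => f (projIcc (-1 : ℝ) 1 (by norm_num) s) :=
    f.continuous.comp continuous_projIcc
  rw [integral_eq (F := fun s => f (projIcc (-1 : ℝ) 1 (by norm_num) s))
    fun s => by rw [projIcc_val]] at h
  ext s
  by_contra hs
  have := intervalIntegral.integral_pos (a := (-1 : ℝ)) (b := 1) (by norm_num) hF.continuousOn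
    (fun x _ => hf _) ⟨s, s.2, by rw [projIcc_val]; exact (hf s).lt_of_ne' hs⟩
  exact this.ne' h

lemma pairing_self_pos {f : C(I, ℝ)} (hf : f ≠ 0) : 0 < pairing ν f f := by
  refine (pairing_self_nonneg _ f).lt_of_ne' fun h => hf ?_
  have := eq_zero_of_integral_eq_zero (f := f * f) (fun s => mul_self_nonneg _) h
  ext s
  exact mul_self_eq_zero.1 (DFunLike.congr_fun this s)

/-- The Green function as a continuous kernel. -/
def kernel (m : ℕ) : C(I × I, ℝ) :=
  ⟨fun x => Function.uncurry (green m) (x.1, x.2), (continuous_green m).comp (by fun_prop)⟩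

lemma kernel_comm (m : ℕ) (s t : I) : kernel m (s, t) = kernel m (t, s) := green_comm m s t

/-- The solution operator of the Dirichlet problem of order `2m + 2`. -/
def solution (m : ℕ) : C(I, ℝ) →ₗ[ℝ] C(I, ℝ) := op ν (kernel m)

lemma solution_apply_eq {m : ℕ} {φ : ℕ → ℝ → ℝ} (h : IsDirichletChain (m + 1) φ) {f : C(I, ℝ)}
    (hf : ∀ s : I, f s = (-1) ^ (m + 1) * φ (2 * (m + 1)) s) (t : I) : solution m f t = φ 0 t := by
  rw [← integral_green_mul h t.2]
  exact integral_eq fun s => by rw [hf]; rfl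

/-- Every continuous function is the right-hand side of a solvable problem, so values of the
operator are classical solutions and no regularity theory is required. -/
lemma exists_chain (m : ℕ) (f : C(I, ℝ)) : ∃ φ, IsDirichletChain (m + 1) φ ∧
    (∀ s : I, f s = (-1) ^ (m + 1) * φ (2 * (m + 1)) s) ∧ ∀ t : I, solution m f t = φ 0 t := by
  have hF : Continuous fun s => (-1) ^ (m + 1) * f (projIcc (-1 : ℝ) 1 (by norm_num) s) :=
    continuous_const.mul (f.continuous.comp continuous_projIcc)
  obtain ⟨φ, hφ, hφF⟩ := exists_isDirichletChain (m + 1) hF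
  have hf : ∀ s : I, f s = (-1) ^ (m + 1) * φ (2 * (m + 1)) s := fun s => by
    simp only [hφF, projIcc_val]
    rw [← mul_assoc, ← mul_pow]; norm_num
  exact ⟨φ, hφ, hf, solution_apply_eq hφ hf⟩

lemma pairing_solution_comm (m : ℕ) (f g : C(I, ℝ)) :
    pairing ν (solution m f) g = pairing ν f (solution m g) :=
  pairing_op_comm _ _ (kernel_comm m) f g

lemma pairing_solution_nonneg (m : ℕ) (f : C(I, ℝ)) : 0 ≤ pairing ν (solution m f) f := by
  obtain ⟨φ, hφ, hf, hs⟩ := exists_chain m f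
  rw [pairing_eq (F := φ 0) (H := fun s => (-1) ^ (m + 1) * φ (2 * (m + 1)) s) hs hf,
    hφ.integral_mul_last]
  exact intervalIntegral.integral_nonneg (by norm_num) fun s _ => sq_nonneg _

lemma solution_mono (m : ℕ) {f g : C(I, ℝ)} (hfg : ∀ x, f x ≤ g x) (t : I) :
    solution m f t ≤ solution m g t :=
  op_mono _ _ (fun s t => green_nonneg m s.2 t.2) hfg t

lemma exists_of_mem_eigenvalues {m : ℕ} {μ : ℝ} (hμ : μ ∈ polyharmonicEigenvalues (m + 1)) :
    ∃ f : C(I, ℝ), f ≠ 0 ∧ f = μ • solution m f := by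
  obtain ⟨ψ, h⟩ := hμ
  set φ := fun j => iteratedDerivWithin j ψ (Icc (-1) 1) with hφ
  have hch : IsDerivChain (2 * (m + 1)) φ := IsDerivChain.of_contDiffOn h.contDiffOn
  have hD : IsDirichletChain (m + 1) φ := ⟨hch, h.left_boundary, h.right_boundary⟩
  have h0 : φ 0 = ψ := iteratedDerivWithin_zero
  have heq : EqOn (fun t => (-1) ^ (m + 1) * φ (2 * (m + 1)) t) (fun t => μ * ψ t)
      (Icc (-1) 1) := by
    -- The equation is assumed only on the open interval; continuity extends it to the end points.
    refine EqOn.of_subset_closure (s := Ioo (-1) 1) h.equation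
      (continuousOn_const.mul hch.continuousOn_last)
      (continuousOn_const.mul h.contDiffOn.continuousOn) Ioo_subset_Icc_self ?_
    rw [closure_Ioo (by norm_num)]
  refine ⟨restrict ψ h.contDiffOn.continuousOn, ?_, ?_⟩
  · obtain ⟨t, ht, hne⟩ := h.ne_zero
    exact fun h0 => hne (DFunLike.congr_fun h0 (⟨t, ht⟩ : I))
  · ext t
    rw [← map_smul, solution_apply_eq hD (fun s => (heq s.2).symm) t, h0]
    rfl

lemma inv_mem_eigenvalues {m : ℕ} {M : ℝ} (hM : M ≠ 0) {f : C(I, ℝ)} (hf : f ≠ 0)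
    (h : solution m f = M • f) : M⁻¹ ∈ polyharmonicEigenvalues (m + 1) := by
  obtain ⟨φ, hφ, hfφ, hs⟩ := exists_chain m f
  have hφf : ∀ t : I, φ 0 t = M * f t := fun t => by rw [← hs, h]; rfl
  have hch := hφ.toIsDerivChain
  refine ⟨φ 0, ⟨hch.contDiffOn, ?_, fun t ht => ?_, fun j hj => ?_, fun j hj => ?_⟩⟩
  · obtain ⟨t, ht⟩ := DFunLike.ne_iff.1 hf
    exact ⟨t, t.2, by rw [hφf]; exact mul_ne_zero hM ht⟩
  · have ht' := Ioo_subset_Icc_self ht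
    rw [hch.iteratedDerivWithin_eq le_rfl ht', hφf ⟨t, ht'⟩, inv_mul_cancel_left₀ hM]
    exact (hfφ ⟨t, ht'⟩).symm
  · rw [hch.iteratedDerivWithin_eq (by omega) (by norm_num), hφ.left j hj]
  · rw [hch.iteratedDerivWithin_eq (by omega) (by norm_num), hφ.right j hj]

/-- The smallest eigenvalue exists and is the reciprocal of the best constant `M` in the
variational principle. -/
theorem isLeast_minEigenvalue (m : ℕ) (hne : ∃ f, 0 < pairing ν (solution m f) f) :
    IsLeast (polyharmonicEigenvalues (m + 1)) (minEigenvalue (m + 1)) ∧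
      0 < minEigenvalue (m + 1) ∧
      ∀ f, minEigenvalue (m + 1) * pairing ν (solution m f) (solution m f) ≤
        pairing ν (solution m f) f := by
  obtain ⟨M, hM, ⟨g, hg, hgM⟩, hray, hsq⟩ := exists_max_eigenvalue ν (kernel m)
    (kernel_comm m) (pairing_solution_nonneg m) hne
  have hleast : IsLeast (polyharmonicEigenvalues (m + 1)) M⁻¹ := by
    refine ⟨inv_mem_eigenvalues hM.ne' hg hgM, fun μ hμ => ?_⟩
    obtain ⟨f, hf, hfμ⟩ := exists_of_mem_eigenvalues hμ
    have h1 := pairing_self_pos hf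
    have h2 : pairing ν f f = μ * pairing ν (solution m f) f := by
      have := congrArg (fun g => pairing ν g f) hfμ
      rwa [map_smul, LinearMap.smul_apply, smul_eq_mul] at this
    have h3 := pairing_solution_nonneg m f
    have h4 : pairing ν (solution m f) f ≤ M * pairing ν f f := hray f
    have hμ0 : 0 < μ := by
      by_contra hneg
      nlinarith [mul_nonneg (neg_nonneg.2 (not_lt.1 hneg)) h3]
    rw [inv_le_iff_one_le_mul₀ hM]
    refine le_of_mul_le_mul_right ?_ h1
    nlinarith
  have hmin : minEigenvalue (m + 1) = M⁻¹ := hleast.csInf_eq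
  refine ⟨by rwa [hmin], by rw [hmin]; positivity, fun f => ?_⟩
  rw [hmin, inv_mul_le_iff₀ hM]
  exact hsq f

/-- Comparison: if `(-1) ^ n u^{(2n)} = w` and `u ≤ c w`, with strict inequality off a small set,
then every positive eigenvalue exceeds `1 / c`. -/
theorem one_lt_mul_of_mem_eigenvalues {m : ℕ} {μ : ℝ} (hμ : μ ∈ polyharmonicEigenvalues (m + 1))
    (hμ0 : 0 < μ) {w : C(I, ℝ)} {c : ℝ} (hw : ∀ s, 0 ≤ w s)
    (hle : ∀ s, solution m w s ≤ c * w s)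
    (hlt : Dense {s | solution m w s < c * w s}) : 1 < μ * c := by
  obtain ⟨f, hf, hfμ⟩ := exists_of_mem_eigenvalues hμ
  -- Monotonicity of the operator applied to `±f ≤ |f|`, together with `f = μ T f`.
  have habs : ∀ t, |f| t ≤ (μ • solution m |f|) t := by
    intro t
    have h1 := solution_mono m (f := f) (g := |f|) (fun s => le_abs_self (f s)) t
    have h2 := solution_mono m (f := -f) (g := |f|) (fun s => neg_le_abs (f s)) t
    have h3 : f t = μ * solution m f t := DFunLike.congr_fun hfμ t
    rw [map_neg, ContinuousMap.neg_apply] at h2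
    change |f t| ≤ μ * solution m |f| t
    rw [abs_le, h3]
    constructor <;> nlinarith
  have h1 : pairing ν |f| w ≤ μ * pairing ν |f| (solution m w) := by
    have := pairing_mono ν habs hw
    rwa [map_smul, LinearMap.smul_apply, smul_eq_mul, pairing_solution_comm] at this
  have hnn : ∀ s, 0 ≤ (|f| * (c • w - solution m w)) s := fun s =>
    mul_nonneg (abs_nonneg (f s)) (sub_nonneg.2 (hle s))
  -- If this vanished, `f` would be zero wherever the comparison is strict, a dense set, hence
  -- everywhere.
  have h2 : 0 < pairing ν |f| (c • w - solution m w) := by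
    refine (integral_nonneg hnn : 0 ≤ pairing ν |f| (c • w - solution m w)).lt_of_ne'
      fun h => hf ?_
    have hz := eq_zero_of_integral_eq_zero (f := |f| * (c • w - solution m w)) hnn h
    refine DFunLike.coe_injective (Continuous.ext_on hlt f.continuous continuous_const ?_)
    intro s hs
    have hs2 : |f s| * (c * w s - solution m w s) = 0 := DFunLike.congr_fun hz s
    exact abs_eq_zero.1 ((mul_eq_zero.1 hs2).resolve_right (sub_pos.2 hs).ne')
  have h3 : 0 ≤ pairing ν |f| w := integral_nonneg fun s => mul_nonneg (abs_nonneg (f s)) (hw s)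
  simp only [map_sub, map_smul, smul_eq_mul, sub_pos] at h2
  have h4 : pairing ν |f| w < (μ * c) * pairing ν |f| w :=
    h1.trans_lt (by rw [mul_assoc]; exact mul_lt_mul_of_pos_left h2 hμ0)
  by_contra h
  nlinarith [not_lt.1 h]

end DirichletGreen

/-! ### Pochhammer identities and the ratio `R_n` -/

/-- The rising factorial `(1/2)_k`. -/
def halfPochhammer (k : ℕ) : ℝ := (ascPochhammer ℝ k).eval (1 / 2)

lemma halfPochhammer_zero : halfPochhammer 0 = 1 := by simp [halfPochhammer]

lemma halfPochhammer_succ (k : ℕ) : halfPochhammer (k + 1) = halfPochhammer k * (k + 1 / 2) := by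
  rw [halfPochhammer, ascPochhammer_succ_eval, halfPochhammer, add_comm (1 / 2 : ℝ)]

lemma halfPochhammer_pos (k : ℕ) : 0 < halfPochhammer k := ascPochhammer_pos k _ (by norm_num)

lemma ascPochhammer_eval_add (x : ℝ) (a b : ℕ) : (ascPochhammer ℝ (a + b)).eval x =
    (ascPochhammer ℝ a).eval x * (ascPochhammer ℝ b).eval (x + a) := by
  rw [← ascPochhammer_mul, eval_mul, eval_comp]
  simp

lemma halfPochhammer_add (a b : ℕ) :
    halfPochhammer (a + b) = halfPochhammer a * (ascPochhammer ℝ b).eval (a + 1 / 2 : ℝ) := by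
  rw [halfPochhammer, ascPochhammer_eval_add, halfPochhammer, add_comm (1 / 2 : ℝ)]

lemma factorial_two_mul_eq (k : ℕ) :
    ((2 * k).factorial : ℝ) = 4 ^ k * k.factorial * halfPochhammer k := by
  induction k with
  | zero => simp [halfPochhammer_zero]
  | succ k ih =>
    rw [show 2 * (k + 1) = 2 * k + 1 + 1 by ring, Nat.factorial_succ, Nat.factorial_succ,
      Nat.factorial_succ, halfPochhammer_succ]
    push_cast
    rw [ih]
    ring

lemma Gamma_add_half_eq (k : ℕ) :
    Real.Gamma ((k : ℝ) + 1 / 2) = halfPochhammer k * Real.Gamma (1 / 2) := by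
  induction k with
  | zero => simp [halfPochhammer_zero]
  | succ k ih =>
    rw [halfPochhammer_succ, Nat.cast_succ, show (k : ℝ) + 1 + 1 / 2 = (k + 1 / 2) + 1 by ring,
      Real.Gamma_add_one (by positivity), ih]
    ring

lemma eigenUpperBound_eq (n : ℕ) :
    eigenUpperBound n = 2 * n.factorial * halfPochhammer (2 * n) / halfPochhammer n := by
  have h1 := Gamma_add_half_eq (2 * n)
  push_cast at h1
  have h2 : Real.Gamma (1 / 2) ≠ 0 := (Real.Gamma_pos_of_pos (by norm_num)).ne'
  have h3 := (halfPochhammer_pos n).ne'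
  rw [eigenUpperBound, Real.Gamma_nat_eq_factorial, h1, Gamma_add_half_eq]
  field_simp

lemma eigenUpperBound_pos (n : ℕ) : 0 < eigenUpperBound n := by
  rw [eigenUpperBound_eq]
  have h1 := halfPochhammer_pos n
  have h2 := halfPochhammer_pos (2 * n)
  positivity

/-- The Chu–Vandermonde identity for rising factorials. -/
theorem sum_antidiagonal_ascPochhammer (x y : ℝ) (N : ℕ) :
    ∑ ij ∈ Finset.HasAntidiagonal.antidiagonal N, (ascPochhammer ℝ ij.1).eval x / ij.1.factorial *
      ((ascPochhammer ℝ ij.2).eval y / ij.2.factorial) =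
        (ascPochhammer ℝ N).eval (x + y) / N.factorial := by
  -- Up to sign these are generalized binomial coefficients at `-z`, which reduces the claim to
  -- Vandermonde for `Ring.choose`.
  have hm : ∀ (z : ℝ) (k : ℕ), (ascPochhammer ℝ k).eval z / k.factorial =
      (-1) ^ k * Ring.choose (-z) k := by
    intro z k
    have h1 := Ring.factorial_nsmul_multichoose_eq_ascPochhammer z k
    rw [ascPochhammer_smeval_eq_eval, nsmul_eq_mul] at h1
    have hk : (k.factorial : ℝ) ≠ 0 := by positivity
    rw [Ring.choose_neg', ← h1, mul_div_cancel_left₀ _ hk]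
    rcases Nat.even_or_odd k with h | h
    · simp [h.neg_one_pow, Int.negOnePow_even _ ((Int.even_coe_nat k).2 h)]
    · simp [h.neg_one_pow, Int.negOnePow_odd _ ((Int.odd_coe_nat k).2 h)]
  simp only [hm]
  rw [neg_add, Ring.add_choose_eq N (Commute.all _ _), Finset.mul_sum]
  refine Finset.sum_congr rfl fun ij hij => ?_
  rw [← Finset.HasAntidiagonal.mem_antidiagonal.1 hij, pow_add]
  ring

/-- The `k`-th term of the series for `ratioR n`. -/
def ratioCoeff (n k : ℕ) : ℝ :=
  halfPochhammer k * n.descFactorial k / ((2 * n - 1).descFactorial k * (n + 1).ascFactorial k)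

lemma ratioCoeff_nonneg (n k : ℕ) : 0 ≤ ratioCoeff n k := by
  have := halfPochhammer_pos k
  unfold ratioCoeff
  positivity

lemma ratioCoeff_pos {n k : ℕ} (hn : 1 ≤ n) (hk : k ≤ n) : 0 < ratioCoeff n k := by
  have h1 := halfPochhammer_pos k
  have h2 : 0 < n.descFactorial k := Nat.descFactorial_pos.2 hk
  have h3 : 0 < (2 * n - 1).descFactorial k := Nat.descFactorial_pos.2 (by omega)
  have h4 : 0 < (n + 1).ascFactorial k := Nat.ascFactorial_pos _ _
  unfold ratioCoeff
  positivity

lemma ratioCoeff_zero (n : ℕ) : ratioCoeff n 0 = 1 := by simp [ratioCoeff, halfPochhammer_zero]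

lemma ratioCoeff_eq_zero {n k : ℕ} (h : n < k) : ratioCoeff n k = 0 := by
  simp [ratioCoeff, Nat.descFactorial_of_lt h]

lemma ascPochhammer_eval_neg_natCast (n k : ℕ) :
    (ascPochhammer ℝ k).eval (-(n : ℝ)) = (-1) ^ k * n.descFactorial k := by
  rw [ascPochhammer_eval_neg_eq_descPochhammer, descPochhammer_eval_eq_descFactorial]

/-- The signs of `(-n)_k` and `(1 - 2n)_k` cancel, as do `(1)_k` and `k!`; positivity of the terms
becomes visible. -/
lemma ratioR_eq_tsum {n : ℕ} (hn : 1 ≤ n) : ratioR n = ∑' k, ratioCoeff n k := by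
  rw [ratioR, hypergeometric3F2]
  refine tsum_congr fun k => ?_
  have h1 : (1 : ℝ) - 2 * n = -((2 * n - 1 : ℕ) : ℝ) := by
    rw [Nat.cast_sub (by omega)]; push_cast; ring
  have h2 : (ascPochhammer ℝ k).eval ((n : ℝ) + 1) = ((n + 1).ascFactorial k : ℝ) := by
    rw [Nat.cast_ascFactorial]; simp
  rw [h1, ascPochhammer_eval_neg_natCast, ascPochhammer_eval_neg_natCast, h2, ← Nat.cast_factorial,
    one_pow, ratioCoeff, halfPochhammer]
  have hk : (k.factorial : ℝ) ≠ 0 := by positivity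
  have hs : ((-1 : ℝ) ^ k) ≠ 0 := by simp
  field_simp

lemma ratioR_eq_sum {n : ℕ} (hn : 1 ≤ n) :
    ratioR n = ∑ k ∈ Finset.range (n + 1), ratioCoeff n k := by
  rw [ratioR_eq_tsum hn]
  refine tsum_eq_sum fun k hk => ratioCoeff_eq_zero ?_
  simpa [Nat.lt_succ_iff] using hk

lemma ratioCoeff_succ_le (n k : ℕ) : ratioCoeff n (k + 1) ≤ ratioCoeff n k * (1 / 2) := by
  rcases lt_or_ge k n with hk | hk
  · have h1 := halfPochhammer_pos k
    have h2 : (0 : ℝ) < n.descFactorial k := by exact_mod_cast Nat.descFactorial_pos.2 hk.le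
    have h3 : (0 : ℝ) < (2 * n - 1).descFactorial k := by
      exact_mod_cast Nat.descFactorial_pos.2 (by omega : k ≤ 2 * n - 1)
    have h4 : (0 : ℝ) < (n + 1).ascFactorial k := by exact_mod_cast Nat.ascFactorial_pos _ _
    -- Writing `n = k + j + 1` removes truncated subtraction from the ratio `(k + 1/2)(n - k) / ((2n
    -- - 1 - k)(n + 1 + k))`.
    obtain ⟨j, rfl⟩ := Nat.exists_eq_add_of_lt hk
    have e1 : k + j + 1 - k = j + 1 := by omega
    have e2 : 2 * (k + j + 1) - 1 - k = k + 2 * j + 1 := by omega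
    have h : ratioCoeff (k + j + 1) (k + 1) = ratioCoeff (k + j + 1) k *
        (((k + 1 / 2) * (j + 1)) / ((k + 2 * j + 1) * (k + j + 1 + 1 + k))) := by
      simp only [ratioCoeff, halfPochhammer_succ, Nat.descFactorial_succ, Nat.ascFactorial_succ, e1,
        e2]
      push_cast
      field_simp
    rw [h]
    refine mul_le_mul_of_nonneg_left ?_ (ratioCoeff_nonneg _ _)
    rw [div_le_iff₀ (by positivity)]
    have hk0 : (0 : ℝ) ≤ k := by positivity
    have hj0 : (0 : ℝ) ≤ j := by positivity
    nlinarith [mul_nonneg hk0 hj0, mul_nonneg hk0 hk0, mul_nonneg hj0 hj0]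
  · rw [ratioCoeff_eq_zero (by omega : n < k + 1)]
    have := ratioCoeff_nonneg n k
    positivity

lemma ratioCoeff_one_le (n : ℕ) : ratioCoeff n 1 ≤ 1 / (n + 1) := by
  rcases n.eq_zero_or_pos with rfl | hn
  · simp [ratioCoeff]
  simp only [ratioCoeff, Nat.descFactorial_one, Nat.ascFactorial_succ, Nat.ascFactorial_zero, halfPochhammer_succ 0,
    halfPochhammer_zero]
  rw [div_le_div_iff₀ (by have : 0 < 2 * n - 1 := by omega
                          positivity) (by positivity), Nat.cast_sub (by omega)]
  have : (1 : ℝ) ≤ n := by exact_mod_cast hn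
  push_cast
  nlinarith

lemma one_le_ratioR {n : ℕ} (hn : 1 ≤ n) : 1 ≤ ratioR n := by
  rw [ratioR_eq_sum hn, ← ratioCoeff_zero n]
  exact Finset.single_le_sum (fun k _ => ratioCoeff_nonneg n k) (by simp)

lemma ratioR_le {n : ℕ} (hn : 1 ≤ n) : ratioR n ≤ 1 + 2 / (n + 1) := by
  have hb : ∀ k, ratioCoeff n (k + 1) ≤ ratioCoeff n 1 * (1 / 2) ^ k := by
    intro k
    induction k with
    | zero => simp
    | succ k ih =>
      refine (ratioCoeff_succ_le n (k + 1)).trans ?_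
      rw [pow_succ]
      linarith
  rw [ratioR_eq_sum hn, Finset.sum_range_succ', ratioCoeff_zero]
  have h1 : ∑ k ∈ Finset.range n, ratioCoeff n (k + 1) ≤ ratioCoeff n 1 * 2 := by
    refine (Finset.sum_le_sum fun k _ => hb k).trans ?_
    rw [← Finset.mul_sum]
    refine mul_le_mul_of_nonneg_left ?_ (ratioCoeff_nonneg n 1)
    refine (summable_geometric_two.sum_le_tsum _ fun k _ => by positivity).trans ?_
    rw [tsum_geometric_two]
  have h2 := ratioCoeff_one_le n
  have h3 : (2 : ℝ) / (n + 1) = 1 / (n + 1) * 2 := by ring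
  linarith

theorem tendsto_ratioR : Tendsto ratioR atTop (𝓝 1) := by
  have h : Tendsto (fun n : ℕ => (1 : ℝ) + 2 / ((n : ℝ) + 1)) atTop (𝓝 1) := by
    have := (tendsto_one_div_add_atTop_nhds_zero_nat (𝕜 := ℝ)).const_mul 2 |>.const_add 1
    simpa [div_eq_mul_inv] using this
  refine tendsto_of_tendsto_of_tendsto_of_le_of_le' tendsto_const_nhds h ?_ ?_ <;>
  filter_upwards [eventually_ge_atTop 1] with n hn
  · exact one_le_ratioR hn
  · exact ratioR_le hn

/-- The coefficient identity behind the comparison function. -/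
theorem sum_ratioCoeff_mul_choose {n r : ℕ} (hn : 1 ≤ n) (hr : r ≤ n) :
    ∑ k ∈ Finset.range (n + 1), ratioCoeff n k * (n + k).choose (n + r) =
      eigenUpperBound n * n.choose r * (2 * r).factorial / (2 * (n + r)).factorial := by
  obtain ⟨m, rfl⟩ := Nat.exists_eq_add_of_le' hn
  obtain ⟨N, hN⟩ := Nat.exists_eq_add_of_le hr
  set n := m + 1 with hnm
  have hzero : ∑ k ∈ Finset.range r, ratioCoeff n k * (n + k).choose (n + r) = 0 :=
    Finset.sum_eq_zero fun k hk => by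
      rw [Nat.choose_eq_zero_of_lt (by have := Finset.mem_range.1 hk; omega)]; simp
  rw [show n + 1 = r + (N + 1) by omega, Finset.sum_range_add, hzero, zero_add]
  -- With `k = r + i` and `i + j = N`, the term splits into a factor free of `i` and `j` times a
  -- Chu–Vandermonde summand for `r + 1/2` and `n`; the factor `(n)_j` comes from `(2n - 1 - k)! =
  -- (m + j)!`.
  have hterm : ∀ ij ∈ Finset.HasAntidiagonal.antidiagonal N,
      ratioCoeff n (r + ij.1) * (n + (r + ij.1)).choose (n + r) =
      halfPochhammer r * (n.factorial : ℝ) ^ 2 * m.factorial /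
        ((2 * m + 1).factorial * (n + r).factorial) *
      ((ascPochhammer ℝ ij.1).eval (r + 1 / 2 : ℝ) / ij.1.factorial *
      ((ascPochhammer ℝ ij.2).eval (n : ℝ) / ij.2.factorial)) := by
    rintro ⟨i, j⟩ hij
    have hij' : i + j = N := Finset.HasAntidiagonal.mem_antidiagonal.1 hij
    have e1 : (n.descFactorial (r + i) : ℝ) = n.factorial / j.factorial := by
      rw [eq_div_iff (by positivity), mul_comm, ← Nat.cast_mul, ← show n - (r + i) = j by omega,
        Nat.factorial_mul_descFactorial (by omega)]
    have e2 : ((2 * n - 1).descFactorial (r + i) : ℝ) =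
        (2 * m + 1).factorial / (m + j).factorial := by
      rw [eq_div_iff (by positivity), mul_comm, ← Nat.cast_mul,
        show 2 * n - 1 = 2 * m + 1 by omega, ← show 2 * m + 1 - (r + i) = m + j by omega,
        Nat.factorial_mul_descFactorial (by omega)]
    have e3 : ((n + 1).ascFactorial (r + i) : ℝ) = (n + (r + i)).factorial / n.factorial := by
      rw [eq_div_iff (by positivity), mul_comm, ← Nat.cast_mul, Nat.factorial_mul_ascFactorial]
    have e4 : ((m + j).factorial : ℝ) = m.factorial * (ascPochhammer ℝ j).eval (n : ℝ) := by
      rw [← Nat.cast_ascFactorial, ← Nat.cast_mul, Nat.factorial_mul_ascFactorial]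
    have e5 : ((n + (r + i)).choose (n + r) : ℝ) =
        (n + (r + i)).factorial / ((n + r).factorial * i.factorial) := by
      rw [Nat.cast_choose ℝ (by omega), show n + (r + i) - (n + r) = i by omega]
    simp only [ratioCoeff]
    rw [e1, e2, e3, e5, e4, halfPochhammer_add]
    have := ascPochhammer_pos j (n : ℝ) (by positivity)
    field_simp
  have hsum := Finset.Nat.sum_antidiagonal_eq_sum_range_succ_mk
    (fun ij : ℕ × ℕ => ratioCoeff n (r + ij.1) * ((n + (r + ij.1)).choose (n + r) : ℝ)) N
  simp only at hsum
  rw [← hsum, Finset.sum_congr rfl hterm, ← Finset.mul_sum, sum_antidiagonal_ascPochhammer,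
    eigenUpperBound_eq]
  have f1 : halfPochhammer (2 * n) =
      halfPochhammer (n + r) * (ascPochhammer ℝ N).eval (r + 1 / 2 + n : ℝ) := by
    rw [show 2 * n = (n + r) + N by omega, halfPochhammer_add]
    push_cast
    congr 2
    ring
  have f2 := factorial_two_mul_eq r
  have f3 := factorial_two_mul_eq (n + r)
  have f4 : (4 : ℝ) ^ n * halfPochhammer n * m.factorial = 2 * (2 * m + 1).factorial := by
    have h := factorial_two_mul_eq n
    rw [show 2 * n = (2 * m + 1) + 1 by omega, hnm] at h
    have hm : (m + 1 : ℝ) ≠ 0 := by positivity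
    refine mul_left_cancel₀ hm ?_
    rw [hnm]
    push_cast [Nat.factorial_succ] at h ⊢
    linarith
  have f5 : (n.choose r : ℝ) = n.factorial / (r.factorial * N.factorial) := by
    rw [Nat.cast_choose ℝ hr, show n - r = N by omega]
  have g1 := (halfPochhammer_pos n).ne'
  have g2 := (halfPochhammer_pos (n + r)).ne'
  have g3 := (halfPochhammer_pos r).ne'
  have f6 : (m.factorial : ℝ) / (2 * m + 1).factorial = 2 / (4 ^ n * halfPochhammer n) := by
    rw [div_eq_div_iff (by positivity) (by positivity)]
    linarith
  rw [f1, f2, f3, f5]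
  rw [show halfPochhammer r * (n.factorial : ℝ) ^ 2 * m.factorial /
        ((2 * m + 1).factorial * (n + r).factorial) = halfPochhammer r * (n.factorial : ℝ) ^ 2 *
        (m.factorial / (2 * m + 1).factorial) / (n + r).factorial by field_simp, f6]
  field_simp
  ring

/-! ### The comparison polynomial -/

lemma coeff_one_sub_X_sq_pow (N i : ℕ) :
    ((1 - X ^ 2 : ℝ[X]) ^ N).coeff (2 * i) = (-1) ^ i * N.choose i := by
  have h : (1 - X ^ 2 : ℝ[X]) ^ N = expand ℝ 2 ((-1) ^ N * (X + C (-1)) ^ N) := by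
    rw [← mul_pow, map_pow]
    simp
    ring
  rw [h, mul_comm 2 i, coeff_expand_mul two_pos,
    show ((-1 : ℝ[X]) ^ N) = C ((-1) ^ N) by simp, coeff_C_mul, coeff_X_add_C_pow]
  rcases le_or_gt i N with hi | hi
  · obtain ⟨j, rfl⟩ := Nat.exists_eq_add_of_le hi
    rw [Nat.add_sub_cancel_left, ← mul_assoc, ← pow_add,
      show i + j + j = i + 2 * j by ring, pow_add, pow_mul]
    norm_num
  · simp [Nat.choose_eq_zero_of_lt hi]

lemma coeff_one_sub_X_sq_pow_odd (N : ℕ) {j : ℕ} (hj : ¬ 2 ∣ j) :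
    ((1 - X ^ 2 : ℝ[X]) ^ N).coeff j = 0 := by
  have h : (1 - X ^ 2 : ℝ[X]) ^ N = expand ℝ 2 ((1 - X) ^ N) := by simp
  rw [h, coeff_expand two_pos, if_neg hj]

lemma eval_one_sub_X_sq_iterate {n j : ℕ} (hj : j < n) {p : ℝ[X]}
    (h : (1 - X ^ 2 : ℝ[X]) ^ n ∣ p) :
    (derivative^[j] p).eval (-1) = 0 ∧ (derivative^[j] p).eval 1 = 0 :=
  ⟨eval_iterate_derivative_of_pow_dvd h (by simp) hj,
    eval_iterate_derivative_of_pow_dvd h (by simp) hj⟩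

lemma isDirichletChain_of_dvd {n : ℕ} {p : ℝ[X]} (h : (1 - X ^ 2 : ℝ[X]) ^ n ∣ p) :
    IsDirichletChain n fun j t => (derivative^[j] p).eval t :=
  ⟨IsDerivChain.of_polynomial _ p, fun _ hj => (eval_one_sub_X_sq_iterate hj h).1,
    fun _ hj => (eval_one_sub_X_sq_iterate hj h).2⟩

/-- `∑ₖ cₖ (1 - X²) ^ (n + k)`, with `cₖ` the terms of `ratioR n`. -/
def comparisonPoly (n : ℕ) : ℝ[X] :=
  ∑ k ∈ Finset.range (n + 1), C (ratioCoeff n k) * (1 - X ^ 2) ^ (n + k)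

lemma pow_dvd_comparisonPoly (n : ℕ) : (1 - X ^ 2 : ℝ[X]) ^ n ∣ comparisonPoly n :=
  Finset.dvd_sum fun _ _ => Dvd.dvd.mul_left (pow_dvd_pow _ (by omega)) _

/-- Comparing coefficients of `X^(2r)` gives exactly `sum_ratioCoeff_mul_choose`; odd coefficients
vanish on both sides. -/
theorem iterate_derivative_comparisonPoly {n : ℕ} (hn : 1 ≤ n) :
    derivative^[2 * n] (comparisonPoly n) =
      C ((-1) ^ n * eigenUpperBound n) * (1 - X ^ 2) ^ n := by
  ext j
  rw [coeff_iterate_derivative, coeff_C_mul, comparisonPoly, finsetSum_coeff]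
  simp only [coeff_C_mul, nsmul_eq_mul]
  by_cases hj : 2 ∣ j
  · obtain ⟨r, rfl⟩ := hj
    simp only [show 2 * r + 2 * n = 2 * (n + r) by ring, coeff_one_sub_X_sq_pow]
    have h : ∑ k ∈ Finset.range (n + 1), ratioCoeff n k * ((-1) ^ (n + r) * (n + k).choose (n + r)) =
        (-1) ^ (n + r) * ∑ k ∈ Finset.range (n + 1), ratioCoeff n k * (n + k).choose (n + r) := by
      rw [Finset.mul_sum]
      exact Finset.sum_congr rfl fun k _ => by ring
    rw [h]
    rcases le_or_gt r n with hr | hr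
    · have hd : ((2 * (n + r)).descFactorial (2 * n) : ℝ) =
          (2 * (n + r)).factorial / (2 * r).factorial := by
        rw [eq_div_iff (by positivity), mul_comm, ← Nat.cast_mul,
          ← show 2 * (n + r) - 2 * n = 2 * r by omega, Nat.factorial_mul_descFactorial (by omega)]
      rw [sum_ratioCoeff_mul_choose hn hr, hd, pow_add]
      field_simp
    · rw [Nat.choose_eq_zero_of_lt hr, Finset.sum_eq_zero]
      · simp
      · intro k hk
        rw [Nat.choose_eq_zero_of_lt (by have := Finset.mem_range.1 hk; omega)]
        simp
  · have hj' : ¬ 2 ∣ j + 2 * n := by omega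
    simp [coeff_one_sub_X_sq_pow_odd _ hj, coeff_one_sub_X_sq_pow_odd _ hj']

theorem iterate_derivative_one_sub_X_sq_pow (n : ℕ) :
    derivative^[2 * n] ((1 - X ^ 2 : ℝ[X]) ^ n) = C ((-1) ^ n * ((2 * n).factorial : ℝ)) := by
  ext j
  rw [coeff_iterate_derivative, coeff_C, nsmul_eq_mul]
  split_ifs with hj
  · subst hj
    rw [zero_add, coeff_one_sub_X_sq_pow, Nat.descFactorial_self]
    simp
    ring
  · rw [coeff_eq_zero_of_natDegree_lt, mul_zero]
    have : ((1 - X ^ 2 : ℝ[X]) ^ n).natDegree ≤ n * 2 :=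
      natDegree_pow_le_of_le n (by compute_degree)
    omega

lemma eval_comparisonPoly (n : ℕ) (t : ℝ) : (comparisonPoly n).eval t =
    (1 - t ^ 2) ^ n * ∑ k ∈ Finset.range (n + 1), ratioCoeff n k * (1 - t ^ 2) ^ k := by
  simp only [comparisonPoly, eval_finsetSum, eval_mul, eval_C, eval_pow, eval_sub, eval_one, eval_X,
    Finset.mul_sum]
  exact Finset.sum_congr rfl fun k _ => by ring

lemma eval_comparisonPoly_le {n : ℕ} (hn : 1 ≤ n) {t : ℝ} (ht : t ∈ Icc (-1 : ℝ) 1) :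
    (comparisonPoly n).eval t ≤ ratioR n * (1 - t ^ 2) ^ n := by
  have h0 : 0 ≤ 1 - t ^ 2 := by nlinarith [ht.1, ht.2]
  rw [eval_comparisonPoly, ratioR_eq_sum hn, mul_comm]
  refine mul_le_mul_of_nonneg_right (Finset.sum_le_sum fun k _ => ?_) (by positivity)
  exact mul_le_of_le_one_right (ratioCoeff_nonneg n k) (pow_le_one₀ h0 (by nlinarith))

lemma eval_comparisonPoly_lt {n : ℕ} (hn : 1 ≤ n) {t : ℝ} (ht : t ∈ Ioo (-1 : ℝ) 1) (ht0 : t ≠ 0) :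
    (comparisonPoly n).eval t < ratioR n * (1 - t ^ 2) ^ n := by
  have h0 : 0 < 1 - t ^ 2 := by nlinarith [ht.1, ht.2]
  have h1 : 1 - t ^ 2 < 1 := by have := pow_pos (abs_pos.2 ht0) 2; rw [sq_abs] at this; linarith
  rw [eval_comparisonPoly, ratioR_eq_sum hn, mul_comm]
  -- The term `k = 1` is already strict: its coefficient is positive and `1 - t² < 1` away from `0`.
  refine mul_lt_mul_of_pos_right (Finset.sum_lt_sum (fun k _ => ?_) ⟨1, by simp; omega, ?_⟩)
    (by positivity)
  · exact mul_le_of_le_one_right (ratioCoeff_nonneg n k) (pow_le_one₀ h0.le h1.le)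
  · rw [pow_one]
    exact mul_lt_of_lt_one_right (ratioCoeff_pos hn hn) h1

lemma eigenLowerBound_eq (n : ℕ) : eigenLowerBound n = eigenUpperBound n / ratioR n := by
  rw [eigenLowerBound, eigenUpperBound, div_div]

lemma integral_one_sub_sq_pow_eq (k : ℕ) : ∫ x in (-1 : ℝ)..1, (1 - x ^ 2) ^ k =
    2 * k.factorial / ((2 * k + 1) * halfPochhammer k) := by
  rw [integral_one_sub_sq_pow, Nat.factorial_succ, Nat.cast_mul, factorial_two_mul_eq]
  have := (halfPochhammer_pos k).ne'
  push_cast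
  field_simp

/-! ### The two eigenvalue bounds -/

namespace DirichletGreen

open ContinuousKernel

/-- The function `(1 - t²) ^ n` on `[-1, 1]`. -/
def weight (n : ℕ) : C(I, ℝ) := restrict (fun t => (1 - t ^ 2) ^ n) (by fun_prop)

@[simp] lemma weight_apply (n : ℕ) (t : I) : weight n t = (1 - (t : ℝ) ^ 2) ^ n := rfl

lemma solution_weight (m : ℕ) (t : I) : solution m (weight (m + 1)) t =
    (comparisonPoly (m + 1)).eval (t : ℝ) / eigenUpperBound (m + 1) := by
  have hU := (eigenUpperBound_pos (m + 1)).ne'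
  rw [solution_apply_eq (isDirichletChain_of_dvd
    ((pow_dvd_comparisonPoly (m + 1)).mul_left (C (eigenUpperBound (m + 1))⁻¹)))]
  · simp [div_eq_inv_mul]
  · intro s
    rw [iterate_derivative_C_mul, iterate_derivative_comparisonPoly (by omega)]
    simp only [weight_apply, eval_mul, eval_C, eval_pow, eval_sub, eval_one, eval_X]
    rw [mul_assoc, mul_left_comm (eigenUpperBound (m + 1))⁻¹, inv_mul_cancel_left₀ hU, ← mul_assoc, ← mul_pow]
    norm_num

lemma solution_one (m : ℕ) (t : I) : solution m 1 t =
    (1 - (t : ℝ) ^ 2) ^ (m + 1) / ((2 * (m + 1)).factorial : ℝ) := by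
  have hf : ((2 * (m + 1)).factorial : ℝ) ≠ 0 := by positivity
  rw [solution_apply_eq (isDirichletChain_of_dvd (Dvd.intro_left
    (C ((2 * (m + 1)).factorial : ℝ)⁻¹) rfl))]
  · simp [div_eq_inv_mul]
  · intro s
    rw [iterate_derivative_C_mul, iterate_derivative_one_sub_X_sq_pow, ← C_mul, eval_C,
      mul_left_comm, ← mul_assoc ((-1 : ℝ) ^ (m + 1)), ← mul_pow]
    simp [hf]

lemma pairing_solution_one (m : ℕ) : pairing ν (solution m 1) 1 =
    (∫ x in (-1 : ℝ)..1, (1 - x ^ 2) ^ (m + 1)) / ((2 * (m + 1)).factorial : ℝ) := by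
  rw [pairing_eq (F := fun t => (1 - t ^ 2) ^ (m + 1) / ((2 * (m + 1)).factorial : ℝ))
      (H := fun _ => 1) (solution_one m) (fun _ => rfl),
    ← intervalIntegral.integral_div]
  simp

lemma pairing_solution_one_solution_one (m : ℕ) :
    pairing ν (solution m 1) (solution m 1) =
      (∫ x in (-1 : ℝ)..1, (1 - x ^ 2) ^ (2 * (m + 1))) / ((2 * (m + 1)).factorial : ℝ) ^ 2 := by
  rw [pairing_eq (F := fun t => (1 - t ^ 2) ^ (m + 1) / ((2 * (m + 1)).factorial : ℝ))
      (H := fun t => (1 - t ^ 2) ^ (m + 1) / ((2 * (m + 1)).factorial : ℝ))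
      (solution_one m) (solution_one m), ← intervalIntegral.integral_div]
  refine intervalIntegral.integral_congr fun x _ => ?_
  rw [two_mul, pow_add]
  ring

lemma exists_pairing_solution_pos (m : ℕ) : ∃ f, 0 < pairing ν (solution m f) f := by
  refine ⟨1, ?_⟩
  have := halfPochhammer_pos (m + 1)
  rw [pairing_solution_one, integral_one_sub_sq_pow_eq]
  positivity

lemma minEigenvalue_lt (m : ℕ) : minEigenvalue (m + 1) < eigenUpperBound (m + 1) := by
  -- The test function is the constant `1`, so the trial solution is a multiple of `(1 - t²)ⁿ`.
  have h := (isLeast_minEigenvalue m (exists_pairing_solution_pos m)).2.2 1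
  rw [pairing_solution_one, pairing_solution_one_solution_one, integral_one_sub_sq_pow_eq,
    integral_one_sub_sq_pow_eq] at h
  rw [eigenUpperBound_eq]
  set n := m + 1
  have h1 := halfPochhammer_pos n
  have h2 := halfPochhammer_pos (2 * n)
  have hf : (0 : ℝ) < (2 * n).factorial := by positivity
  have h3 : minEigenvalue n ≤
      n.factorial * halfPochhammer (2 * n) / halfPochhammer n * ((4 * n + 1) / (2 * n + 1)) := by
    push_cast at h
    refine le_of_mul_le_mul_right (h.trans_eq ?_) (by positivity :
      0 < 2 * ((2 * n).factorial : ℝ) / ((2 * (2 * (n : ℝ)) + 1) * halfPochhammer (2 * n)) /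
        ((2 * n).factorial : ℝ) ^ 2)
    field_simp
    ring
  have h4 : ((4 * n + 1 : ℝ) / (2 * n + 1)) < 2 := by
    rw [div_lt_iff₀ (by positivity)]
    linarith
  refine h3.trans_lt ((mul_lt_mul_of_pos_left h4 (by positivity)).trans_eq ?_)
  ring

lemma dense_setOf_interior_ne_zero : Dense {s : I | (s : ℝ) ∈ Ioo (-1 : ℝ) 1 ∧ (s : ℝ) ≠ 0} := by
  intro s
  have h1 : Ioo (-1 : ℝ) 1 ∩ {0}ᶜ ⊆ Icc (-1) 1 := fun x hx => Ioo_subset_Icc_self hx.1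
  have h2 : Icc (-1) 1 ⊆ closure (Ioo (-1 : ℝ) 1 ∩ {0}ᶜ) := by
    rw [← closure_Ioo (by norm_num : (-1 : ℝ) ≠ 1)]
    exact closure_minimal ((dense_compl_singleton (0 : ℝ)).open_subset_closure_inter isOpen_Ioo)
      isClosed_closure
  rw [closure_subtype]
  have h3 : (Subtype.val '' {s : I | (s : ℝ) ∈ Ioo (-1 : ℝ) 1 ∧ (s : ℝ) ≠ 0}) =
      Ioo (-1 : ℝ) 1 ∩ {0}ᶜ := by
    ext x
    exact ⟨fun ⟨s, hs, hx⟩ => hx ▸ hs, fun hx => ⟨⟨x, h1 hx⟩, hx, rfl⟩⟩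
  rw [h3]
  exact h2 s.2

lemma lt_minEigenvalue (m : ℕ) : eigenLowerBound (m + 1) < minEigenvalue (m + 1) := by
  obtain ⟨hleast, hpos, -⟩ := isLeast_minEigenvalue m (exists_pairing_solution_pos m)
  have hU := eigenUpperBound_pos (m + 1)
  have hR : 0 < ratioR (m + 1) := zero_lt_one.trans_le (one_le_ratioR (by omega))
  have h := one_lt_mul_of_mem_eigenvalues hleast.1 hpos (w := weight (m + 1))
    (c := ratioR (m + 1) / eigenUpperBound (m + 1)) (fun s => ?_) (fun s => ?_)
    (dense_setOf_interior_ne_zero.mono fun s hs => ?_)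
  · rw [eigenLowerBound_eq, div_lt_iff₀ hR]
    rwa [← mul_div_assoc, one_lt_div hU] at h
  · have := s.2
    exact pow_nonneg (by nlinarith [this.1, this.2]) _
  · rw [solution_weight, div_mul_eq_mul_div, weight_apply]
    exact div_le_div_of_nonneg_right (eval_comparisonPoly_le (by omega) s.2) hU.le
  · rw [mem_ofPred_eq, solution_weight, div_mul_eq_mul_div, weight_apply]
    exact div_lt_div_of_pos_right (eval_comparisonPoly_lt (by omega) hs.1 hs.2) hU

end DirichletGreen

/-! ### Asymptotics from the Wallis product -/

lemma wallis_eq_halfPochhammer (n : ℕ) :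
    Real.Wallis.W n = (n.factorial / halfPochhammer n) ^ 2 / (2 * n + 1) := by
  have := (halfPochhammer_pos n).ne'
  rw [Real.Wallis.W_eq_factorial_ratio, factorial_two_mul_eq, pow_mul]
  norm_num
  rw [show (16 : ℝ) = 4 ^ 2 by norm_num, ← pow_mul]
  field_simp
  ring

theorem tendsto_eigenUpperBound_div :
    Tendsto (fun n : ℕ => eigenUpperBound n / (√2 * ((2 * n).factorial : ℝ))) atTop (𝓝 1) := by
  have hW := Real.Wallis.tendsto_W_nhds_pi_div_two
  have h2 : Tendsto (fun n : ℕ => 2 * n) atTop atTop := tendsto_id.const_mul_atTop' two_pos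
  have hq : Tendsto (fun n : ℕ => Real.Wallis.W n / Real.Wallis.W (2 * n)) atTop (𝓝 1) := by
    have := hW.div (hW.comp h2) (by positivity)
    rwa [div_self (by positivity)] at this
  have hr : Tendsto (fun n : ℕ => (2 * (2 * n + 1) : ℝ) / (4 * n + 1)) atTop (𝓝 1) := by
    have h : Tendsto (fun n : ℕ => (1 : ℝ) + 1 / ((4 * n : ℕ) + 1)) atTop (𝓝 (1 + 0)) :=
      ((tendsto_one_div_add_atTop_nhds_zero_nat (𝕜 := ℝ)).comp
        (tendsto_id.const_mul_atTop' (by norm_num : 0 < 4))).const_add 1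
    rw [add_zero] at h
    refine h.congr fun n => ?_
    push_cast
    field_simp
    ring
  -- The square of the quotient in question is `W n / W (2n) · 2(2n + 1) / (4n + 1)`.
  have h := (hq.mul hr).sqrt
  rw [mul_one, Real.sqrt_one] at h
  refine h.congr fun n => ?_
  have h1 := halfPochhammer_pos n
  have h3 := halfPochhammer_pos (2 * n)
  rw [eigenUpperBound_eq]
  refine (congrArg _ ?_).trans (Real.sqrt_sq (by positivity))
  rw [wallis_eq_halfPochhammer, wallis_eq_halfPochhammer]
  have hs : √(2 : ℝ) ^ 2 = 2 := Real.sq_sqrt (by norm_num)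
  simp only [div_pow, mul_pow, hs]
  push_cast
  field_simp
  ring

end

theorem mainTheorem1 :
    (∀ n : ℕ, 1 ≤ n →
      IsLeast (polyharmonicEigenvalues n) (minEigenvalue n) ∧
        eigenLowerBound n < minEigenvalue n ∧ minEigenvalue n < eigenUpperBound n) ∧
    Tendsto ratioR atTop (𝓝 1) ∧
    (minEigenvalue ~[atTop] eigenLowerBound) ∧
    (minEigenvalue ~[atTop] eigenUpperBound) ∧
    (minEigenvalue ~[atTop] fun n : ℕ => Real.sqrt 2 * ((2 * n).factorial : ℝ)) := by
  have hbounds : ∀ n : ℕ, 1 ≤ n →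
      IsLeast (polyharmonicEigenvalues n) (minEigenvalue n) ∧
        eigenLowerBound n < minEigenvalue n ∧ minEigenvalue n < eigenUpperBound n := by
    intro n hn
    obtain ⟨m, rfl⟩ := Nat.exists_eq_add_of_le' hn
    exact ⟨(DirichletGreen.isLeast_minEigenvalue m
      (DirichletGreen.exists_pairing_solution_pos m)).1, DirichletGreen.lt_minEigenvalue m,
      DirichletGreen.minEigenvalue_lt m⟩
  have hinv : Tendsto (fun n => 1 / ratioR n) atTop (𝓝 1) := by
    simpa using tendsto_ratioR.inv₀ one_ne_zero
  have hLU : eigenLowerBound ~[atTop] eigenUpperBound := by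
    refine isEquivalent_of_tendsto_one (hinv.congr fun n => ?_)
    have := (eigenUpperBound_pos n).ne'
    rw [Pi.div_apply, eigenLowerBound_eq]
    field_simp
  -- The two bounds squeeze `λ_n / U` between `1 / R_n` and `1`.
  have hU : minEigenvalue ~[atTop] eigenUpperBound := by
    refine isEquivalent_of_tendsto_one
      (tendsto_of_tendsto_of_tendsto_of_le_of_le' hinv tendsto_const_nhds ?_ ?_) <;>
    filter_upwards [eventually_ge_atTop 1] with n hn
    · have h := (hbounds n hn).2.1
      rw [eigenLowerBound_eq] at h
      rw [Pi.div_apply, le_div_iff₀ (eigenUpperBound_pos n), one_div_mul_eq_div]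
      exact h.le
    · rw [Pi.div_apply, div_le_one (eigenUpperBound_pos n)]
      exact (hbounds n hn).2.2.le
  exact ⟨hbounds, tendsto_ratioR, hU.trans hLU.symm, hU,
    hU.trans (isEquivalent_of_tendsto_one tendsto_eigenUpperBound_div)⟩
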